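/- **Setting.** Let $N\in\mathbb N$, and write $\mathbf X=(\mathbf x_1,\dots,\mathbf x_N)\in\mathbb R^{dN}$. Let $\mathfrak h$ be a complex Hilbert space and $\omega\ge 0$ an injective self-adjoint, possibly unbounded, operator on $\mathfrak h$. Let $\mathfrak h_\omega$ be the Hilbert completion of $\bigcap_{k}\mathscr D(\omega^k)$ with respect to $\langle\,\cdot\,|\,\omega\,|\,\cdot\,\rangle_{\mathfrak h}$; the operator $\omega^{1/2}$ extends to a unitary map $\mathfrak h_\omega\to\mathfrak h$, with inverse denoted by $\omega^{-1/2}$, and for $z\in\mathfrak h_\omega$ and $v\in\mathscr D(\omega^{-1/2})$ we write $\langle z|v\rangle:=\langle\omega^{1/2}z|\omega^{-1/2}v\rangle_{\mathfrak h}$. Let $\mathcal W\in L^1_{\mathrm{loc}}(\mathbb R^{dN})$, $\mathcal W\ge0$. The quasi-classical energy is the quadratic form $\mathcal E_{\mathrm{qc}}[\psi,z]=\langle\psi|\mathcal H_z|\psi\rangle$, set equal to $+\infty$ unless $\psi\in H^1(\mathbb R^{dN})$ and $\int\mathcal W|\psi|^2<\infty$, in one of the following models. (a) *Nelson model*: $d\in\{1,2,3\}$,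 $\lambda,\omega^{-1/2}\lambda\in L^\infty(\mathbb R^d;\mathfrak h)$, and $$\mathcal H_z=\sum_{j}\bigl(-\Delta_j+2\,\mathrm{Re}\,\langle z|\lambda(\mathbf x_j)\rangle\bigr)+\mathcal W+\|z\|^2_{\mathfrak h_\omega}.$$ (b) *Polaron*: $d\in\{1,2,3\}$, $\mathfrak h=\mathfrak h_\omega=L^2(\mathbb R^d)$, $\omega=1$, $\alpha>0$, $\lambda(\mathbf x;\mathbf k)=\sqrt\alpha\,e^{-i\mathbf k\cdot\mathbf x}|\mathbf k|^{-(d-1)/2}$, and $\mathcal H_z$ as in (a), where the form of $2\,\mathrm{Re}\,\langle z|\lambda(\mathbf x_j)\rangle$ is understood as $2\sqrt\alpha\,\mathrm{Re}\,\langle\psi|\,g_<(\mathbf x_j)+[-i\nabla_j,\mathbf g_>(\mathbf x_j)]\,|\psi\rangle$ with, for any fixed $\varrho>0$, $$g_<(\mathbf x)=\int_{|\mathbf k|\le\varrho}e^{i\mathbf k\cdot\mathbf x}|\mathbf k|^{-\frac{d-1}2}z(\mathbf k)\,d\mathbf k,\qquad \mathbf g_>(\mathbf x)=\int_{|\mathbf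 k|>\varrho}e^{i\mathbf k\cdot\mathbf x}|\mathbf k|^{-\frac{d+1}2}\tfrac{\mathbf k}{|\mathbf k|}z(\mathbf k)\,d\mathbf k,$$ $$\langle\psi|[-i\nabla_j,\mathbf g_>(\mathbf x_j)]|\psi\rangle:=\langle -i\nabla_j\psi|\mathbf g_>(\mathbf x_j)\psi\rangle-\langle\psi|\mathbf g_>(\mathbf x_j)\cdot(-i\nabla_j\psi)\rangle .$$ (c) *Pauli–Fierz model*: $d=3$, $m_j>0$, $e\in\mathbb R$, $\boldsymbol\lambda_j=(\lambda_{j,1},\lambda_{j,2},\lambda_{j,3})$ with $\lambda_{j,\ell},\omega^{\pm1/2}\lambda_{j,\ell}\in L^\infty(\mathbb R^3;\mathfrak h)$ and $\nabla\cdot\boldsymbol\lambda_j=0$ weakly, and $$\mathcal H_z=\sum_j\tfrac1{2m_j}\bigl(-i\nabla_j+2e\,\mathrm{Re}\,\langle z|\boldsymbol\lambda_j(\mathbf x_j)\rangle\bigr)^2+\mathcal W+\|z\|^2_{\mathfrak h_\omega}.$$ Let $\mathcal F_{\mathrm{qc}}[\psi,\eta]:=\mathcal E_{\mathrm{qc}}[\psi,\omega^{-1/2}\eta]$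 for $\eta\in\mathfrak h$, let $\mathcal E_{\mathrm{Pekar}}[\psi]:=\inf_{\eta\in\mathfrak h}\mathcal F_{\mathrm{qc}}[\psi,\eta]$, and let $E_{\mathrm{qc}}$, $E_{\mathrm{Pekar}}$ be the infima of $\mathcal E_{\mathrm{qc}}$ and $\mathcal E_{\mathrm{Pekar}}$ over the sets $\mathscr D_{\mathrm{qc}}\subset L^2(\mathbb R^{dN})\times\mathfrak h_\omega$ and $\mathscr D_{\mathrm{Pekar}}\subset L^2(\mathbb R^{dN})$ of configurations with $\|\psi\|_2=1$ and finite energy. A minimizer is an element of the domain at which the infimum is attained. **Proposition (Equivalence of variational problems).** In each of the models (a), (b), (c): 1. $E_{\mathrm{Pekar}}=E_{\mathrm{qc}}>-\infty$. 2. If $(\psi_{\mathrm{qc}},z_{\mathrm{qc}})\in\mathscr D_{\mathrm{qc}}$ is a minimizer of $\mathcal E_{\mathrm{qc}}$, then $\psi_{\mathrm{qc}}$ is a minimizer of $\mathcal E_{\mathrm{Pekar}}$, i.e. $\mathcal E_{\mathrm{Pekar}}[\psi_{\mathrm{qc}}]=E_{\mathrm{Pekar}}$. 3. For every $\psi\in\mathscr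 D_{\mathrm{Pekar}}$ the functional $\eta\mapsto\mathcal F_{\mathrm{qc}}[\psi,\eta]$ is strictly convex on $\mathfrak h$ and has exactly one minimizer $\eta_{\mathrm{Pekar}}[\psi]\in\mathfrak h$, which is the unique solution $\eta\in\mathfrak h$ of $$\eta+\Bigl\langle\psi\Bigl|\sum_j(\omega^{-1/2}\lambda)(\mathbf x_j)\Bigr|\psi\Bigr\rangle_{L^2(\mathbb R^{dN})}=0$$ in the cases (a) and (b) (in case (b) as an identity for almost every $\mathbf k$), and in case (c), with $\boldsymbol\xi_j=\omega^{-1/2}\boldsymbol\lambda_j$, of $$\eta+\sum_j\tfrac1{m_j}\bigl\langle\psi\bigl|e\,\boldsymbol\xi_j(\mathbf x_j)\cdot(-i\nabla_j)+2e^2\,\boldsymbol\xi_j(\mathbf x_j)\cdot\mathrm{Re}\,\langle\eta|\boldsymbol\xi_j(\mathbf x_j)\rangle_{\mathfrak h}\bigr|\psi\bigr\rangle_{L^2(\mathbb R^{3N})}=0 .$$ 4. Conversely, if $\psi_{\mathrm{Pekar}}$ is a minimizer of $\mathcal E_{\mathrm{Pekar}}$ and $\eta=\eta_{\mathrm{Pekar}}[\psi_{\mathrm{Pekar}}]$,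 then $(\psi_{\mathrm{Pekar}},\omega^{-1/2}\eta)\in\mathscr D_{\mathrm{qc}}$ is a minimizer of $\mathcal E_{\mathrm{qc}}$, i.e. $\mathcal F_{\mathrm{qc}}[\psi_{\mathrm{Pekar}},\eta]=E_{\mathrm{qc}}$. -/

import Mathlib

open MeasureTheory
open scoped InnerProductSpace SchwartzMap LineDeriv

noncomputable section

/-- A non-negative self-adjoint, possibly unbounded, operator `ω` on the complex Hilbert space `𝔥`
which is injective, so that it has a (possibly unbounded) inverse. -/
structure Dispersion (𝔥 : Type*) [NormedAddCommGroup 𝔥] [InnerProductSpace ℂ 𝔥]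
    [CompleteSpace 𝔥] where
  /-- the underlying densely defined operator -/
  op : 𝔥 →ₗ.[ℂ] 𝔥
  selfAdjoint : IsSelfAdjoint op
  nonneg : ∀ x : op.domain, 0 ≤ (⟪(x : 𝔥), op x⟫_ℂ).re
  injective : ∀ x : op.domain, op x = 0 → x = 0

namespace Dispersion

variable {𝔥 : Type*} [NormedAddCommGroup 𝔥] [InnerProductSpace ℂ 𝔥] [CompleteSpace 𝔥]

/-- `S` is the non-negative self-adjoint square root of `A`: it is self-adjoint, non-negative, and
`S ∘ S = A`, domains included. -/
def IsSqrt (S A : 𝔥 →ₗ.[ℂ] 𝔥) : Prop :=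
  IsSelfAdjoint S ∧ (∀ x : S.domain, 0 ≤ (⟪(x : 𝔥), S x⟫_ℂ).re) ∧
    ∀ x y : 𝔥, (x, y) ∈ A.graph ↔ ∃ w : 𝔥, (x, w) ∈ S.graph ∧ (w, y) ∈ S.graph

theorem symm_of_isSelfAdjoint {A : 𝔥 →ₗ.[ℂ] 𝔥} (hA : IsSelfAdjoint A) {x y u v : 𝔥}
    (hx : (x, y) ∈ A.graph) (hu : (u, v) ∈ A.graph) : ⟪y, u⟫_ℂ = ⟪x, v⟫_ℂ := by
  obtain ⟨a, rfl, rfl⟩ := (LinearPMap.mem_graph_iff A).1 hx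
  obtain ⟨b, rfl, rfl⟩ := (LinearPMap.mem_graph_iff A).1 hu
  have h := LinearPMap.adjoint_isFormalAdjoint (T := A) hA.dense_domain
  rw [LinearPMap.isSelfAdjoint_def.1 hA] at h
  exact (h a b)

theorem mem_graph_of_isSelfAdjoint {A : 𝔥 →ₗ.[ℂ] 𝔥} (hA : IsSelfAdjoint A) {y w : 𝔥}
    (h : ∀ u v : 𝔥, (u, v) ∈ A.graph → ⟪w, u⟫_ℂ = ⟪y, v⟫_ℂ) : (y, w) ∈ A.graph := by
  have hy : y ∈ A.adjoint.domain :=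
    LinearPMap.mem_adjoint_domain_of_exists _ ⟨w, fun x => h x (A x) (A.mem_graph x)⟩
  have e : A.adjoint ⟨y, hy⟩ = w :=
    LinearPMap.adjoint_apply_eq hA.dense_domain ⟨y, hy⟩ (fun x => h x (A x) (A.mem_graph x))
  have m : (y, w) ∈ A.adjoint.graph := (LinearPMap.mem_graph_iff _).2 ⟨⟨y, hy⟩, rfl, e⟩
  rwa [LinearPMap.isSelfAdjoint_def.1 hA] at m

theorem isSelfAdjoint_of_graph {A : 𝔥 →ₗ.[ℂ] 𝔥} (hd : Dense (A.domain : Set 𝔥))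
    (hs : ∀ x y u v : 𝔥, (x, y) ∈ A.graph → (u, v) ∈ A.graph → ⟪y, u⟫_ℂ = ⟪x, v⟫_ℂ)
    (hm : ∀ y w : 𝔥, (∀ u v : 𝔥, (u, v) ∈ A.graph → ⟪w, u⟫_ℂ = ⟪y, v⟫_ℂ) → (y, w) ∈ A.graph) :
    IsSelfAdjoint A := by
  rw [LinearPMap.isSelfAdjoint_def]
  refine le_antisymm ?_ ?_
  · refine LinearPMap.le_of_le_graph ?_
    rintro ⟨y, w⟩ hyw
    obtain ⟨a, rfl, rfl⟩ := (LinearPMap.mem_graph_iff _).1 hyw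
    refine hm _ _ ?_
    intro u v huv
    obtain ⟨b, rfl, rfl⟩ := (LinearPMap.mem_graph_iff A).1 huv
    exact LinearPMap.adjoint_isFormalAdjoint hd a b
  · refine LinearPMap.IsFormalAdjoint.le_adjoint hd ?_
    intro a b
    exact hs _ _ _ _ (A.mem_graph a) (A.mem_graph b)

variable (ω : Dispersion 𝔥)

theorem graph_nonneg {x y : 𝔥} (h : (x, y) ∈ ω.op.graph) : 0 ≤ (⟪x, y⟫_ℂ).re := by
  obtain ⟨a, rfl, rfl⟩ := (LinearPMap.mem_graph_iff _).1 h
  exact ω.nonneg a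

theorem graph_injective {x : 𝔥} (h : (x, 0) ∈ ω.op.graph) : x = 0 := by
  obtain ⟨a, rfl, h0⟩ := (LinearPMap.mem_graph_iff _).1 h
  simpa using congrArg Subtype.val (ω.injective a h0)

theorem norm_sq_add_le {x y : 𝔥} (h : (x, y) ∈ ω.op.graph) :
    ‖x‖ ^ 2 + ‖y‖ ^ 2 ≤ ‖x + y‖ ^ 2 := by
  have h1 := norm_add_sq (𝕜 := ℂ) x y
  have h2 := ω.graph_nonneg h
  simp only [RCLike.re_to_complex] at h1
  linarith

/-- The resolvent `(1 + ω)⁻¹`. -/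
theorem exists_resolvent : ∃ R : 𝔥 →L[ℂ] 𝔥,
    (∀ y, (R y, y - R y) ∈ ω.op.graph) ∧ ∀ x y, (x, y) ∈ ω.op.graph → R (x + y) = x := by
  have hc : IsClosed (ω.op.graph : Set (𝔥 × 𝔥)) := ω.selfAdjoint.isClosed
  have : CompleteSpace ω.op.graph := hc.completeSpace_coe
  let L : ω.op.graph →L[ℂ] 𝔥 :=
    (ContinuousLinearMap.fst ℂ 𝔥 𝔥 + ContinuousLinearMap.snd ℂ 𝔥 𝔥).comp ω.op.graph.subtypeL
  have hL : ∀ p : ω.op.graph, L p = p.1.1 + p.1.2 := fun p => rfl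
  have hb : ∀ p : ω.op.graph, ‖p‖ ≤ ‖L p‖ := by
    intro p
    have h := ω.norm_sq_add_le (x := p.1.1) (y := p.1.2) p.2
    rw [hL]
    have e : ‖p‖ = max ‖p.1.1‖ ‖p.1.2‖ := rfl
    rw [e]
    refine max_le ?_ ?_
    · exact le_of_sq_le_sq (by nlinarith [sq_nonneg ‖p.1.2‖]) (norm_nonneg _)
    · exact le_of_sq_le_sq (by nlinarith [sq_nonneg ‖p.1.1‖]) (norm_nonneg _)
  have hanti : AntilipschitzWith 1 L := by
    refine AddMonoidHomClass.antilipschitz_of_bound L ?_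
    intro p; simpa using hb p
  have hker : LinearMap.ker (L : ω.op.graph →ₗ[ℂ] 𝔥) = ⊥ :=
    LinearMap.ker_eq_bot.2 hanti.injective
  have hcr : IsClosed (LinearMap.range (L : ω.op.graph →ₗ[ℂ] 𝔥) : Set 𝔥) := by
    exact hanti.isClosed_range L.uniformContinuous
  have hrange : LinearMap.range (L : ω.op.graph →ₗ[ℂ] 𝔥) = ⊤ := by
    have : (LinearMap.range (L : ω.op.graph →ₗ[ℂ] 𝔥)).topologicalClosure = ⊤ := by
      rw [Submodule.topologicalClosure_eq_top_iff, Submodule.eq_bot_iff]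
      intro y hy
      have h0 : ∀ u v : 𝔥, (u, v) ∈ ω.op.graph → ⟪-y, u⟫_ℂ = ⟪y, v⟫_ℂ := by
        intro u v huv
        have := (Submodule.mem_orthogonal' _ _).1 hy (u + v) ⟨⟨(u, v), huv⟩, rfl⟩
        rw [inner_add_right] at this
        rw [inner_neg_left]
        linear_combination -this
      have h1 := mem_graph_of_isSelfAdjoint ω.selfAdjoint h0
      have h2 := ω.norm_sq_add_le h1
      simp only [add_neg_cancel, norm_zero, norm_neg] at h2
      have : ‖y‖ = 0 := by nlinarith [norm_nonneg y]
      simpa using this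
    rwa [hcr.submodule_topologicalClosure_eq] at this
  let e := ContinuousLinearEquiv.ofBijective L hker hrange
  have he : ∀ p, e p = p.1.1 + p.1.2 := fun p => rfl
  refine ⟨(ContinuousLinearMap.fst ℂ 𝔥 𝔥).comp (ω.op.graph.subtypeL.comp
    (e.symm : 𝔥 →L[ℂ] ω.op.graph)), ?_, ?_⟩
  · intro y
    have h1 : (e.symm y).1.1 + (e.symm y).1.2 = y := by rw [← he, e.apply_symm_apply]
    have h2 := (e.symm y).2
    have h3 : (e.symm y).1.2 = y - (e.symm y).1.1 := eq_sub_of_add_eq' h1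
    have h4 : ((e.symm y).1.1, y - (e.symm y).1.1) ∈ ω.op.graph := by rw [← h3]; exact h2
    exact h4
  · intro x y h
    have : e.symm (x + y) = ⟨(x, y), h⟩ := by
      rw [ContinuousLinearEquiv.symm_apply_eq, he]
    change (e.symm (x + y)).1.1 = x
    rw [this]

/-- The resolvent `(1 + ω)⁻¹`. -/
def resolvent : 𝔥 →L[ℂ] 𝔥 := ω.exists_resolvent.choose

theorem resolvent_mem (y : 𝔥) : (ω.resolvent y, y - ω.resolvent y) ∈ ω.op.graph :=
  ω.exists_resolvent.choose_spec.1 y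

theorem resolvent_add {x y : 𝔥} (h : (x, y) ∈ ω.op.graph) : ω.resolvent (x + y) = x :=
  ω.exists_resolvent.choose_spec.2 x y h

theorem resolvent_symm (x y : 𝔥) : ⟪ω.resolvent x, y⟫_ℂ = ⟪x, ω.resolvent y⟫_ℂ := by
  have h := symm_of_isSelfAdjoint ω.selfAdjoint (ω.resolvent_mem x) (ω.resolvent_mem y)
  rw [inner_sub_left, inner_sub_right] at h
  linear_combination -h

theorem resolvent_nonneg : 0 ≤ ω.resolvent := by
  rw [ContinuousLinearMap.nonneg_iff_isPositive, ContinuousLinearMap.isPositive_def]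
  refine ⟨fun x y => ω.resolvent_symm x y, fun x => ?_⟩
  have h := ω.graph_nonneg (ω.resolvent_mem x)
  rw [inner_sub_right, Complex.sub_re] at h
  have h2 : 0 ≤ (⟪ω.resolvent x, ω.resolvent x⟫_ℂ).re := inner_self_nonneg (𝕜 := ℂ)
  change 0 ≤ (⟪ω.resolvent x, x⟫_ℂ).re
  linarith

theorem resolvent_le_one : 0 ≤ 1 - ω.resolvent := by
  rw [ContinuousLinearMap.nonneg_iff_isPositive, ContinuousLinearMap.isPositive_def]
  refine ⟨fun x y => ?_, fun x => ?_⟩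
  · simp only [ContinuousLinearMap.coe_coe, sub_apply,
      one_apply_eq_self, inner_sub_left, inner_sub_right, ω.resolvent_symm x y]
  have h := ω.graph_nonneg (ω.resolvent_mem x)
  have h2 : 0 ≤ (⟪x - ω.resolvent x, x - ω.resolvent x⟫_ℂ).re := inner_self_nonneg (𝕜 := ℂ)
  change 0 ≤ (⟪x - ω.resolvent x, x⟫_ℂ).re
  have h3 : ⟪x - ω.resolvent x, x⟫_ℂ =
      ⟪x - ω.resolvent x, x - ω.resolvent x⟫_ℂ + ⟪x - ω.resolvent x, ω.resolvent x⟫_ℂ := by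
    rw [← inner_add_right, sub_add_cancel]
  have h4 : (⟪x - ω.resolvent x, ω.resolvent x⟫_ℂ).re =
    (⟪ω.resolvent x, x - ω.resolvent x⟫_ℂ).re := inner_re_symm (𝕜 := ℂ) _ _
  rw [h3, Complex.add_re, h4]
  linarith

theorem resolvent_injective {y : 𝔥} (h : ω.resolvent y = 0) : y = 0 := by
  have h1 := ω.resolvent_mem y
  rw [h, sub_zero] at h1
  obtain ⟨a, ha, hb⟩ := (LinearPMap.mem_graph_iff _).1 h1
  have : a = 0 := Subtype.ext ha
  rw [this] at hb
  simpa using hb.symm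

theorem one_sub_resolvent_injective {y : 𝔥} (h : y - ω.resolvent y = 0) : y = 0 := by
  have h1 := ω.resolvent_mem y
  rw [h] at h1
  exact ω.resolvent_injective (ω.graph_injective h1)

theorem exists_sqrt_aux : ∃ S : 𝔥 →ₗ.[ℂ] 𝔥, IsSqrt S ω.op ∧
    ∀ u : 𝔥, (CFC.sqrt ω.resolvent u, CFC.sqrt (1 - ω.resolvent) u) ∈ S.graph := by
  set R := ω.resolvent with hR
  set A := CFC.sqrt R with hA
  set B := CFC.sqrt (1 - R) with hB
  have hA0 : 0 ≤ A := CFC.sqrt_nonneg _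
  have hB0 : 0 ≤ B := CFC.sqrt_nonneg _
  have hAA : A * A = R := CFC.sqrt_mul_sqrt_self R ω.resolvent_nonneg
  have hBB : B * B = 1 - R := CFC.sqrt_mul_sqrt_self _ ω.resolvent_le_one
  have hcomm : Commute A B := by
    have h1 : Commute R (1 - R) := (Commute.one_right R).sub_right (Commute.refl R)
    have h2 : Commute A (1 - R) := by
      rw [hA, CFC.sqrt_eq_real_sqrt R ω.resolvent_nonneg]
      exact h1.cfcₙ_real _
    rw [hB, CFC.sqrt_eq_real_sqrt (1 - R) ω.resolvent_le_one]
    exact (h2.symm.cfcₙ_real _).symm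
  have aa : ∀ u, A (A u) = R u := fun u => by rw [← hAA]; rfl
  have bb : ∀ u, B (B u) = u - R u := fun u => by
    have : (B * B) u = (1 - R) u := by rw [hBB]
    simpa using this
  have ab : ∀ u, A (B u) = B (A u) := fun u => by
    have : (A * B) u = (B * A) u := by rw [hcomm.eq]
    exact this
  have dec : ∀ u, A (A u) + B (B u) = u := fun u => by rw [aa, bb]; simp
  have sA : ∀ u v, ⟪A u, v⟫_ℂ = ⟪u, A v⟫_ℂ :=
    ((ContinuousLinearMap.nonneg_iff_isPositive _).1 hA0).isSymmetric
  have sB : ∀ u v, ⟪B u, v⟫_ℂ = ⟪u, B v⟫_ℂ :=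
    ((ContinuousLinearMap.nonneg_iff_isPositive _).1 hB0).isSymmetric
  have injA : ∀ u, A u = 0 → u = 0 := fun u hu => by
    apply ω.resolvent_injective
    rw [← hR, ← aa, hu, map_zero]
  let G : Submodule ℂ (𝔥 × 𝔥) := LinearMap.range ((A : 𝔥 →ₗ[ℂ] 𝔥).prod (B : 𝔥 →ₗ[ℂ] 𝔥))
  have hG : ∀ x y, (x, y) ∈ G ↔ ∃ u, A u = x ∧ B u = y := by
    intro x y
    constructor
    · rintro ⟨u, hu⟩
      exact ⟨u, congrArg Prod.fst hu, congrArg Prod.snd hu⟩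
    · rintro ⟨u, rfl, rfl⟩
      exact ⟨u, rfl⟩
  have hgr : G.toLinearPMap.graph = G := by
    refine Submodule.toLinearPMap_graph_eq G ?_
    rintro ⟨x, y⟩ hx h0
    obtain ⟨u, hu1, hu2⟩ := (hG x y).1 hx
    simp only at h0
    rw [h0] at hu1
    rw [injA u hu1, map_zero] at hu2
    exact hu2.symm
  have hS : ∀ x y, (x, y) ∈ G.toLinearPMap.graph ↔ ∃ u, A u = x ∧ B u = y := by
    intro x y; rw [hgr]; exact hG x y
  refine ⟨G.toLinearPMap, ⟨?_, ?_, ?_⟩, fun u => (hS _ _).2 ⟨u, rfl, rfl⟩⟩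
  · refine isSelfAdjoint_of_graph ?_ ?_ ?_
    · rw [Submodule.dense_iff_topologicalClosure_eq_top, Submodule.topologicalClosure_eq_top_iff,
        Submodule.eq_bot_iff]
      intro y hy
      refine injA y (ext_inner_right ℂ fun u => ?_)
      rw [sA, inner_zero_left]
      obtain ⟨a, ha, -⟩ := (LinearPMap.mem_graph_iff _).1 ((hS (A u) (B u)).2 ⟨u, rfl, rfl⟩)
      refine (Submodule.mem_orthogonal' _ _).1 hy (A u) ?_
      rw [← show (a : 𝔥) = A u from ha]
      exact a.2
    · intro x y u v hxy huv
      obtain ⟨a, rfl, rfl⟩ := (hS _ _).1 hxy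
      obtain ⟨b, rfl, rfl⟩ := (hS _ _).1 huv
      rw [sB, sA, ab]
    · intro y w h
      have h1 : A w = B y := by
        refine ext_inner_right ℂ fun u => ?_
        rw [sA, sB]
        exact h (A u) (B u) ((hS _ _).2 ⟨u, rfl, rfl⟩)
      refine (hS _ _).2 ⟨A y + B w, ?_, ?_⟩
      · rw [map_add, ab, h1, dec]
      · rw [map_add, ← ab, ← h1, dec]
  · intro x
    obtain ⟨u, hu1, hu2⟩ := (hS _ _).1 (G.toLinearPMap.mem_graph x)
    rw [← hu1, ← hu2]
    have h := (ContinuousLinearMap.nonneg_iff_isPositive _).1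
      ((commute_iff_mul_nonneg hA0 hB0).1 hcomm)
    have h2 := h.re_inner_nonneg_right u
    rw [sA]
    exact h2
  · intro x y
    constructor
    · intro h
      have hx := ω.resolvent_add h
      rw [← hR] at hx
      refine ⟨B (A (x + y)), (hS _ _).2 ⟨A (x + y), ?_, rfl⟩, (hS _ _).2 ⟨B (x + y), ab _, ?_⟩⟩
      · rw [aa, hx]
      · rw [bb, hx]; simp
    · rintro ⟨w, h1, h2⟩
      obtain ⟨u, rfl, rfl⟩ := (hS _ _).1 h1
      obtain ⟨v, hv1, rfl⟩ := (hS _ _).1 h2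
      have e1 : R (A u + B v) = A u := by
        rw [← aa, map_add, ab, hv1, dec]
      have e2 : A u + B v - R (A u + B v) = B v := by rw [e1]; simp
      have h3 := ω.resolvent_mem (A u + B v)
      rw [← hR, e2, e1] at h3
      exact h3

/-- The operator `ω^{1/2}`, i.e. the non-negative self-adjoint square root of `ω`. -/
def half : 𝔥 →ₗ.[ℂ] 𝔥 := ω.exists_sqrt_aux.choose

theorem half_isSqrt : IsSqrt ω.half ω.op := ω.exists_sqrt_aux.choose_spec.1

theorem half_mem_graph (u : 𝔥) :
    (CFC.sqrt ω.resolvent u, CFC.sqrt (1 - ω.resolvent) u) ∈ ω.half.graph :=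
  ω.exists_sqrt_aux.choose_spec.2 u

/-- The operator `ω^{-1/2}`, with domain the range of `ω^{1/2}`. -/
def negHalf : 𝔥 →ₗ.[ℂ] 𝔥 := ω.half.inverse

/-- The vector `ω^{1/2} v` for `v` in the domain of `ω^{1/2}` (and `0` otherwise). -/
def halfApply (v : 𝔥) : 𝔥 :=
  open scoped Classical in if h : v ∈ ω.half.domain then ω.half ⟨v, h⟩ else 0

/-- The vector `ω^{-1/2} v` for `v` in the domain of `ω^{-1/2}` (and `0` otherwise). -/
def negHalfApply (v : 𝔥) : 𝔥 :=
  open scoped Classical in if h : v ∈ ω.negHalf.domain then ω.negHalf ⟨v, h⟩ else 0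

/-- The domain `𝓓(ω^k)` of the powers of `ω`. -/
def domPow : ℕ → Submodule ℂ 𝔥
  | 0 => ⊤
  | k + 1 => ((domPow k).comap ω.op.toFun).map ω.op.domain.subtype

theorem mem_domPow_succ {k : ℕ} {x : 𝔥} :
    x ∈ ω.domPow (k + 1) ↔ ∃ y, (x, y) ∈ ω.op.graph ∧ y ∈ ω.domPow k := by
  constructor
  · rintro ⟨a, ha, rfl⟩
    exact ⟨ω.op a, ω.op.mem_graph a, ha⟩
  · rintro ⟨y, h, hy⟩
    obtain ⟨a, rfl, rfl⟩ := (LinearPMap.mem_graph_iff _).1 h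
    exact ⟨a, hy, rfl⟩

/-- The vectors `⋂ₖ 𝓓(ω^k)`. -/
def smoothVectors : Submodule ℂ 𝔥 := ⨅ k, ω.domPow k

theorem smoothVectors_le_domain : ω.smoothVectors ≤ ω.op.domain := by
  intro x hx
  obtain ⟨a, -, rfl⟩ := (Submodule.mem_iInf _).1 hx 1
  exact a.2

/-- The space `⋂ₖ 𝓓(ω^k)`, to be equipped with the scalar product `⟨x, ω y⟩`. -/
def FieldCore : Type _ := ω.smoothVectors

instance : AddCommGroup ω.FieldCore := inferInstanceAs (AddCommGroup ω.smoothVectors)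

instance : Module ℂ ω.FieldCore := inferInstanceAs (Module ℂ ω.smoothVectors)

/-- The inclusion of `⋂ₖ 𝓓(ω^k)` in the domain of `ω`. -/
def toDomain : ω.FieldCore →ₗ[ℂ] ω.op.domain :=
  Submodule.inclusion ω.smoothVectors_le_domain

/-- The scalar product `⟨x, ω y⟩` on `⋂ₖ 𝓓(ω^k)`. -/
@[reducible]
def fieldPreCore : PreInnerProductSpace.Core ℂ ω.FieldCore where
  inner x y := ⟪(ω.toDomain x : 𝔥), ω.op (ω.toDomain y)⟫_ℂ
  conj_inner_symm x y := by
    rw [inner_conj_symm]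
    exact symm_of_isSelfAdjoint ω.selfAdjoint (ω.op.mem_graph _) (ω.op.mem_graph _)
  re_inner_nonneg x := ω.nonneg _
  add_left x y z := by simp
  smul_left x y r := by simp [mul_comm]

instance : SeminormedAddCommGroup ω.FieldCore :=
  InnerProductSpace.Core.toSeminormedAddCommGroup (c := ω.fieldPreCore)

instance : InnerProductSpace ℂ ω.FieldCore := InnerProductSpace.ofCore ω.fieldPreCore

theorem fieldCore_norm_sq (x : ω.FieldCore) :
    ‖x‖ ^ 2 = (⟪(ω.toDomain x : 𝔥), ω.op (ω.toDomain x)⟫_ℂ).re :=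
  norm_sq_eq_re_inner (𝕜 := ℂ) x

/-- The classical field space `𝔥_ω`: the Hilbert completion of `⋂ₖ 𝓓(ω^k)` with respect to the
scalar product `⟨x, ω y⟩`. -/
abbrev FieldSpace : Type _ := UniformSpace.Completion ω.FieldCore

theorem smoothVectors_le_half_domain : ω.smoothVectors ≤ ω.half.domain := by
  intro x hx
  have h := ω.op.mem_graph ⟨x, ω.smoothVectors_le_domain hx⟩
  obtain ⟨w, hw, -⟩ := (ω.half_isSqrt.2.2 _ _).1 h
  obtain ⟨a, ha, -⟩ := (LinearPMap.mem_graph_iff _).1 hw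
  rw [← show (a : 𝔥) = x from ha]
  exact a.2

/-- The restriction of `ω^{1/2}` to `⋂ₖ 𝓓(ω^k)`. -/
def halfCoreLin : ω.FieldCore →ₗ[ℂ] 𝔥 :=
  ω.half.toFun.comp (Submodule.inclusion ω.smoothVectors_le_half_domain)

theorem halfCoreLin_mem (x : ω.FieldCore) :
    ((ω.toDomain x : 𝔥), ω.halfCoreLin x) ∈ ω.half.graph :=
  ω.half.mem_graph (Submodule.inclusion ω.smoothVectors_le_half_domain x)

theorem norm_halfCoreLin (x : ω.FieldCore) : ‖ω.halfCoreLin x‖ = ‖x‖ := by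
  have h : ‖ω.halfCoreLin x‖ ^ 2 = ‖x‖ ^ 2 := by
    rw [fieldCore_norm_sq]
    obtain ⟨w, hw1, hw2⟩ := (ω.half_isSqrt.2.2 _ _).1 (ω.op.mem_graph (ω.toDomain x))
    have e : w = ω.halfCoreLin x := LinearPMap.mem_graph_snd_inj' _ hw1 (ω.halfCoreLin_mem x) rfl
    rw [← symm_of_isSelfAdjoint ω.half_isSqrt.1 hw1 hw2, e]
    exact norm_sq_eq_re_inner (𝕜 := ℂ) _
  exact (sq_eq_sq₀ (norm_nonneg _) (norm_nonneg _)).1 h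

/-- The restriction of `ω^{1/2}` to `⋂ₖ 𝓓(ω^k)` is an isometry for the norm of `𝔥_ω`. -/
def halfCore : ω.FieldCore →ₗᵢ[ℂ] 𝔥 := ⟨ω.halfCoreLin, ω.norm_halfCoreLin⟩

theorem resolvent_pow_mem (k : ℕ) (v : 𝔥) : (ω.resolvent ^ k) v ∈ ω.domPow k := by
  induction k generalizing v with
  | zero => exact Submodule.mem_top
  | succ k ih =>
    refine ω.mem_domPow_succ.2 ⟨_, ?_, ih (v - ω.resolvent v)⟩
    have h := ω.resolvent_mem ((ω.resolvent ^ k) v)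
    have e : ω.resolvent ((ω.resolvent ^ k) v) = (ω.resolvent ^ k) (ω.resolvent v) := by
      have : (ω.resolvent * ω.resolvent ^ k) v = (ω.resolvent ^ k * ω.resolvent) v := by
        rw [← pow_succ, ← pow_succ']
      exact this
    rw [map_sub, ← e, pow_succ']
    exact h

theorem cfc_mem_smoothVectors {δ : ℝ} (hδ : 0 < δ) (v : 𝔥) :
    cfc (fun t : ℝ => max 0 (t - δ)) ω.resolvent v ∈ ω.smoothVectors := by
  have hsa : IsSelfAdjoint ω.resolvent := .of_nonneg ω.resolvent_nonneg
  refine (Submodule.mem_iInf _).2 fun k => ?_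
  have hc : Continuous fun t : ℝ => max 0 (t - δ) / (max t δ) ^ k := by
    refine Continuous.div (by fun_prop) (by fun_prop) fun t => ?_
    have : 0 < max t δ := lt_max_of_lt_right hδ
    positivity
  have e : (fun t : ℝ => max 0 (t - δ)) = fun t => t ^ k * (max 0 (t - δ) / (max t δ) ^ k) := by
    funext t
    rcases le_total t δ with h | h
    · simp [max_eq_left (sub_nonpos.2 h)]
    · have : t ≠ 0 := by linarith
      rw [max_eq_left h]
      field_simp
  rw [e, cfc_mul (fun t : ℝ => t ^ k) _ _ (by fun_prop) hc.continuousOn, cfc_pow_id _ _]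
  exact ω.resolvent_pow_mem k _

theorem denseRange_halfCore : DenseRange ω.halfCore := by
  have hsa : IsSelfAdjoint ω.resolvent := .of_nonneg ω.resolvent_nonneg
  set R := ω.resolvent with hR
  set A := CFC.sqrt R with hA
  set B := CFC.sqrt (1 - R) with hB
  have hB0 : 0 ≤ B := CFC.sqrt_nonneg _
  have sB : ∀ u v, ⟪B u, v⟫_ℂ = ⟪u, B v⟫_ℂ :=
    ((ContinuousLinearMap.nonneg_iff_isPositive _).1 hB0).isSymmetric
  have hBB : B * B = 1 - R := CFC.sqrt_mul_sqrt_self _ ω.resolvent_le_one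
  let Q : ℝ → 𝔥 →L[ℂ] 𝔥 := fun δ => cfc (fun t : ℝ => max 0 (t - δ)) R
  have sQ : ∀ δ u v, ⟪Q δ u, v⟫_ℂ = ⟪u, Q δ v⟫_ℂ := fun δ =>
    ContinuousLinearMap.isSelfAdjoint_iff_isSymmetric.1 (cfc_predicate _ _)
  have hAQ : ∀ δ u, A (Q δ u) = Q δ (A u) := by
    intro δ u
    have h1 : Commute R (Q δ) := ((Commute.refl R).cfc_real _).symm
    have h2 : Commute A (Q δ) := by
      rw [hA, CFC.sqrt_eq_real_sqrt R ω.resolvent_nonneg]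
      exact h1.cfcₙ_real _
    have : (A * Q δ) u = (Q δ * A) u := by rw [h2.eq]
    exact this
  have hd : ((LinearMap.range ω.halfCore.toLinearMap).topologicalClosure) = ⊤ := by
    rw [Submodule.topologicalClosure_eq_top_iff, Submodule.eq_bot_iff]
    intro y hy
    have h1 : ∀ δ, 0 < δ → Q δ (B y) = 0 := by
      intro δ hδ
      refine ext_inner_right ℂ fun u => ?_
      rw [sQ, sB, inner_zero_left]
      have hx : A (Q δ u) ∈ ω.smoothVectors := by
        rw [hAQ]; exact ω.cfc_mem_smoothVectors hδ _
      have e : ω.halfCore ⟨A (Q δ u), hx⟩ = B (Q δ u) :=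
        LinearPMap.mem_graph_snd_inj' _ (ω.halfCoreLin_mem ⟨A (Q δ u), hx⟩)
          (ω.half_mem_graph (Q δ u)) rfl
      exact (Submodule.mem_orthogonal' _ _).1 hy _ ⟨⟨A (Q δ u), hx⟩, e⟩
    have h2 : ∀ δ, 0 < δ → ‖R - Q δ‖ ≤ δ := by
      intro δ hδ
      have e : R - Q δ = cfc (fun t : ℝ => t - max 0 (t - δ)) R := by
        rw [cfc_sub (fun t : ℝ => t) _ R (by fun_prop) (by fun_prop), cfc_id' ℝ R]
      rw [e]
      refine norm_cfc_le hδ.le fun t ht => ?_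
      have ht0 : 0 ≤ t := spectrum_nonneg_of_nonneg ω.resolvent_nonneg ht
      rw [Real.norm_eq_abs, abs_le]
      rcases le_total t δ with h | h
      · rw [max_eq_left (by linarith)]; constructor <;> linarith
      · rw [max_eq_right (by linarith)]; constructor <;> linarith
    have h3 : R (B y) = 0 := by
      have hb : ∀ δ, 0 < δ → ‖R (B y)‖ ≤ δ * ‖B y‖ := by
        intro δ hδ
        have e : R (B y) = (R - Q δ) (B y) := by simp [h1 δ hδ]
        rw [e]
        exact (ContinuousLinearMap.le_opNorm _ _).trans
          (mul_le_mul_of_nonneg_right (h2 δ hδ) (norm_nonneg _))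
      have : ‖R (B y)‖ ≤ 0 := by
        refine le_of_forall_pos_le_add fun ε hε => ?_
        have := hb (ε / (‖B y‖ + 1)) (by positivity)
        refine this.trans ?_
        rw [zero_add, div_mul_eq_mul_div, div_le_iff₀ (by positivity)]
        nlinarith [norm_nonneg (B y)]
      simpa using this
    have h4 : B y = 0 := ω.resolvent_injective h3
    apply ω.one_sub_resolvent_injective
    have : (B * B) y = (1 - R) y := by rw [hBB]
    have h5 : B (B y) = y - R y := this
    rw [← hR, ← h5, h4, map_zero]
  have := Submodule.dense_iff_topologicalClosure_eq_top.2 hd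
  exact this

/-- The continuous extension of `ω^{1/2}` to `𝔥_ω`, as a linear map. -/
def halfExtL : ω.FieldSpace →L[ℂ] 𝔥 :=
  ω.halfCore.toContinuousLinearMap.extend
    (UniformSpace.Completion.toComplL (𝕜 := ℂ) (E := ω.FieldCore))

theorem halfExtL_coe (x : ω.FieldCore) :
    ω.halfExtL (x : ω.FieldSpace) = ω.halfCore x :=
  ContinuousLinearMap.extend_eq ω.halfCore.toContinuousLinearMap
    UniformSpace.Completion.denseRange_coe
    (UniformSpace.Completion.isUniformInducing_coe _) x

theorem norm_halfExtL (z : ω.FieldSpace) : ‖ω.halfExtL z‖ = ‖z‖ := by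
  induction z using UniformSpace.Completion.induction_on with
  | hp => exact isClosed_eq (by fun_prop) (by fun_prop)
  | ih x => rw [halfExtL_coe, LinearIsometry.norm_map, UniformSpace.Completion.norm_coe]

theorem halfExtL_surjective : Function.Surjective ω.halfExtL := by
  have hi : Isometry ω.halfExtL := AddMonoidHomClass.isometry_of_norm _ ω.norm_halfExtL
  have hc : IsClosed (Set.range ω.halfExtL) := hi.isClosedEmbedding.isClosed_range
  have hd : DenseRange ω.halfExtL := by
    refine ω.denseRange_halfCore.mono ?_
    rintro _ ⟨x, rfl⟩
    exact ⟨x, ω.halfExtL_coe x⟩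
  rw [← Set.range_eq_univ, ← hc.closure_eq]
  exact hd.closure_range

/-- The unitary map `𝔥_ω → 𝔥`, `z ↦ η = ω^{1/2} z`, extending `ω^{1/2}` from `⋂ₖ 𝓓(ω^k)` by
continuity; its inverse is `η ↦ ω^{-1/2} η`. -/
def halfIso : ω.FieldSpace ≃ₗᵢ[ℂ] 𝔥 :=
  LinearIsometryEquiv.ofSurjective ⟨ω.halfExtL.toLinearMap, ω.norm_halfExtL⟩ ω.halfExtL_surjective

/-- The pairing `⟨z, v⟩_𝔥 = ⟨ω^{1/2} z, ω^{-1/2} v⟩_𝔥` of a field `z ∈ 𝔥_ω` with a vector `v` in the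
domain of `ω^{-1/2}`. -/
def pairing (z : ω.FieldSpace) (v : 𝔥) : ℂ := ⟪ω.halfIso z, ω.negHalfApply v⟫_ℂ

end Dispersion

/-! ### The particles -/

/-- The space `ℝ^d` of one particle. -/
abbrev Position (d : ℕ) : Type := EuclideanSpace ℝ (Fin d)

/-- The configuration space `ℝ^{dN}`; the coordinate `(j, ℓ)` is the `ℓ`-th coordinate of the
`j`-th particle. -/
abbrev Config (d N : ℕ) : Type := EuclideanSpace ℝ (Fin N × Fin d)

/-- The position `x_j` of the `j`-th particle. -/
def particle {d N : ℕ} (j : Fin N) (X : Config d N) : Position d :=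
  WithLp.toLp 2 fun ℓ => X (j, ℓ)

/-- The particle Hilbert space `L²(ℝ^{dN})`. -/
abbrev Wave (d N : ℕ) : Type := Lp ℂ 2 (volume : Measure (Config d N))

/-- `ψ ∈ H¹(ℝ^{dN})`. -/
def InH1 {d N : ℕ} (ψ : Wave d N) : Prop :=
  TemperedDistribution.MemSobolev 1 2 (ψ : 𝓢'(Config d N, ℂ))

/-- `g ∈ L²` is the distributional derivative of `ψ` in the `ℓ`-th coordinate of particle `j`. -/
def HasWeakPartial {d N : ℕ} (ψ : Wave d N) (j : Fin N) (ℓ : Fin d) (g : Wave d N) : Prop :=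
  ∂_{(EuclideanSpace.single (j, ℓ) (1 : ℝ) : Config d N)} (ψ : 𝓢'(Config d N, ℂ)) =
    (g : 𝓢'(Config d N, ℂ))

/-- The component `-i ∂_{j,ℓ} ψ` of `-i ∇_j ψ`, for `ψ ∈ H¹` (and `0` if the distributional
derivative is not in `L²`). -/
def momentum {d N : ℕ} (ψ : Wave d N) (j : Fin N) (ℓ : Fin d) : Wave d N :=
  open scoped Classical in
  if h : ∃ g, HasWeakPartial ψ j ℓ g then (-Complex.I) • h.choose else 0

/-- The form domain `𝒬(-Δ + W)`: the `ψ ∈ H¹` with `∫ W |ψ|² < ∞`. -/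
def formDomain {d N : ℕ} (W : Config d N → ℝ) : Set (Wave d N) :=
  {ψ | InH1 ψ ∧ Integrable fun X => W X * ‖ψ X‖ ^ 2}

/-- The quadratic form of `𝒦₀ = ∑_j (-Δ_j) + W`, on its form domain. -/
def freeForm {d N : ℕ} (W : Config d N → ℝ) (ψ : Wave d N) : ℝ :=
  (∑ j, ∑ ℓ, ‖momentum ψ j ℓ‖ ^ 2) + ∫ X, W X * ‖ψ X‖ ^ 2

/-- An admissible external potential: `W ∈ L¹_loc`, `W ≥ 0`. -/
def IsPotential {d N : ℕ} (W : Config d N → ℝ) : Prop :=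
  LocallyIntegrable W ∧ ∀ᵐ X, 0 ≤ W X

/-! ### The Nelson model -/

section Models

variable {𝔥 : Type*} [NormedAddCommGroup 𝔥] [InnerProductSpace ℂ 𝔥] [CompleteSpace 𝔥]

/-- `v ∈ L^∞(ℝ^d; 𝔥)`, `v(x)` lies in the domain of `ω^{-1/2}` for almost all `x`, and
`ω^{-1/2} v ∈ L^∞(ℝ^d; 𝔥)`. -/
def IsFormFactor (ω : Dispersion 𝔥) {d : ℕ} (v : Position d → 𝔥) : Prop :=
  MemLp v ⊤ ∧ (∀ᵐ x, v x ∈ ω.negHalf.domain) ∧ MemLp (fun x => ω.negHalfApply (v x)) ⊤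

/-- The quasi-classical energy `⟨ψ, 𝓗_z ψ⟩` of the Nelson model, as a quadratic form, with
`𝓗_z = 𝒦₀ + ∑_j 2 Re ⟨z, lam(x_j)⟩ + ⟨z, ω z⟩`; it is `+∞` outside of the form domain. -/
def nelsonEnergy {d N : ℕ} (ω : Dispersion 𝔥) (lam : Position d → 𝔥) (W : Config d N → ℝ)
    (ψ : Wave d N) (z : ω.FieldSpace) : EReal :=
  open scoped Classical in
  if ψ ∈ formDomain W then
    ((freeForm W ψ + (∫ X, (∑ j, 2 * (ω.pairing z (lam (particle j X))).re) * ‖ψ X‖ ^ 2)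
      + ‖z‖ ^ 2 : ℝ) : EReal)
  else ⊤

/-- The equation `η + ⟨ψ, Λ ψ⟩ = 0` in `𝔥`, where `Λ(X) = ∑_j (ω^{-1/2} lam)(x_j)`. -/
def nelsonFieldEq {d N : ℕ} (ω : Dispersion 𝔥) (lam : Position d → 𝔥)
    (ψ : Wave d N) (η : 𝔥) : Prop :=
  η + ∫ X, (‖ψ X‖ ^ 2) • ∑ j, ω.negHalfApply (lam (particle j X)) = 0

/-! ### The Pauli-Fierz model -/

/-- The weak Coulomb gauge condition `∇ · v = 0` for `v : ℝ³ → 𝔥³`. -/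
def IsDivergenceFree (v : Fin 3 → Position 3 → 𝔥) : Prop :=
  ∀ φ : Position 3 → ℝ, ContDiff ℝ ((⊤ : ℕ∞) : WithTop ℕ∞) φ → HasCompactSupport φ →
    ∫ x, ∑ ℓ, (fderiv ℝ φ x (EuclideanSpace.single ℓ 1)) • v ℓ x = 0

/-- The component `ℓ` of the classical vector potential, `a_{z,j}(x) = 2 Re ⟨z, lam_j(x)⟩`. -/
def vectorPotential {N : ℕ} (ω : Dispersion 𝔥) (lam : Fin N → Fin 3 → Position 3 → 𝔥)
    (z : ω.FieldSpace) (j : Fin N) (ℓ : Fin 3) (x : Position 3) : ℝ :=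
  2 * (ω.pairing z (lam j ℓ x)).re

/-- The quasi-classical energy `⟨ψ, 𝓗_z ψ⟩` of the Pauli-Fierz model, as a quadratic form, with
`𝓗_z = ∑_j (2 m_j)⁻¹ (-i ∇_j + e a_{z,j}(x_j))² + W + ⟨z, ω z⟩`; it is `+∞` outside of the form
domain. -/
def pauliFierzEnergy {N : ℕ} (ω : Dispersion 𝔥) (m : Fin N → ℝ) (e : ℝ)
    (lam : Fin N → Fin 3 → Position 3 → 𝔥) (W : Config 3 N → ℝ)
    (ψ : Wave 3 N) (z : ω.FieldSpace) : EReal :=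
  open scoped Classical in
  if ψ ∈ formDomain W then
    (((∑ j, 1 / (2 * m j) * (∑ ℓ, (∫ X, ‖momentum ψ j ℓ X
        + (e * vectorPotential ω lam z j ℓ (particle j X) : ℝ) * ψ X‖ ^ 2)))
      + (∫ X, W X * ‖ψ X‖ ^ 2) + ‖z‖ ^ 2 : ℝ) : EReal)
  else ⊤

/-- The equation
`η + ∑_j m_j⁻¹ ⟨ψ, (e ξ_j · (-i ∇_j) + 2 e² ξ_j · Re ⟨η, ξ_j⟩) ψ⟩ = 0` in `𝔥`, where
`ξ_j = (ω^{-1/2} lam_j)(x_j)`. -/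
def pauliFierzFieldEq {N : ℕ} (ω : Dispersion 𝔥) (m : Fin N → ℝ) (e : ℝ)
    (lam : Fin N → Fin 3 → Position 3 → 𝔥) (ψ : Wave 3 N) (η : 𝔥) : Prop :=
  η + ∑ j, (1 / m j) • ∑ ℓ, ∫ X,
    (e * (starRingEnd ℂ (ψ X) * momentum ψ j ℓ X)
      + 2 * e ^ 2 * (⟪η, ω.negHalfApply (lam j ℓ (particle j X))⟫_ℂ).re * ‖ψ X‖ ^ 2 : ℂ)
      • ω.negHalfApply (lam j ℓ (particle j X)) = 0

end Models

/-! ### The polaron -/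

/-- The field space `L²(ℝ^d)` of the polaron. -/
abbrev PhononSpace (d : ℕ) : Type := Lp ℂ 2 (volume : Measure (Position d))

/-- The low-momentum form factor `1_{|k| ≤ ϱ} |k|^{-(d-1)/2}`. -/
def lowFactor (d : ℕ) (ϱ : ℝ) (k : Position d) : ℝ :=
  if ‖k‖ ≤ ϱ then ‖k‖ ^ (-((d : ℝ) - 1) / 2) else 0

/-- The component `ℓ` of the high-momentum form factor `1_{|k| > ϱ} |k|^{-(d+1)/2} k / |k|`. -/
def highFactor (d : ℕ) (ϱ : ℝ) (ℓ : Fin d) (k : Position d) : ℝ :=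
  if ϱ < ‖k‖ then ‖k‖ ^ (-((d : ℝ) + 1) / 2) * (k ℓ / ‖k‖) else 0

/-- The inverse Fourier integral `∫ e^{i k · x} f(k) z(k) dk`. -/
def invFourierInt {d : ℕ} (f : Position d → ℝ) (z : PhononSpace d) (x : Position d) : ℂ :=
  ∫ k, Complex.exp (Complex.I * (⟪k, x⟫_ℝ : ℝ)) * (f k : ℂ) * z k

/-- The quadratic form `⟨ψ, [-i ∇_j, G(x_j)] ψ⟩ = ⟨-i ∇_j ψ, G(x_j) ψ⟩ - ⟨ψ, G(x_j) · (-i ∇_j ψ)⟩`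
for a bounded vector function `G` on `ℝ^d`. -/
def commutatorForm {d N : ℕ} (G : Fin d → Position d → ℂ) (j : Fin N) (ψ : Wave d N) : ℂ :=
  ∑ ℓ, ∫ X, (starRingEnd ℂ (momentum ψ j ℓ X) * (G ℓ (particle j X) * ψ X)
    - starRingEnd ℂ (ψ X) * (G ℓ (particle j X) * momentum ψ j ℓ X))

/-- The quadratic form of the polaron potential
`𝒱_z(x) = 2 Re ⟨z, lam(x)⟩`, `lam(x; k) = √α e^{-i k · x} / |k|^{(d-1)/2}`, in the variable `x_j`.
Since `lam(x) ∉ L²(ℝ^d)`, it is understood through the splitting, at the momentum `ϱ > 0`,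
`conj ⟨z, lam(x)⟩ = √α (𝓕⁻¹[lam_< z](x) + [-i ∇_x, 𝓕⁻¹[lam_> z](x)])`,
where both inverse Fourier transforms are bounded functions. -/
def polaronPotentialForm {d N : ℕ} (α ϱ : ℝ) (z : PhononSpace d) (j : Fin N) (ψ : Wave d N) : ℝ :=
  √α * (2 * ((∫ X, invFourierInt (lowFactor d ϱ) z (particle j X) * (‖ψ X‖ ^ 2 : ℝ))
    + commutatorForm (fun ℓ => invFourierInt (highFactor d ϱ ℓ) z) j ψ).re)

/-- The quasi-classical energy `⟨ψ, 𝓗_z ψ⟩` of the polaron, as a quadratic form, with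
`𝓗_z = 𝒦₀ + ∑_j 𝒱_z(x_j) + ‖z‖²`; it is `+∞` outside of the form domain. -/
def polaronEnergy {d N : ℕ} (α ϱ : ℝ) (W : Config d N → ℝ)
    (ψ : Wave d N) (z : PhononSpace d) : EReal :=
  open scoped Classical in
  if ψ ∈ formDomain W then
    ((freeForm W ψ + (∑ j, polaronPotentialForm α ϱ z j ψ) + ‖z‖ ^ 2 : ℝ) : EReal)
  else ⊤

/-- The form factor `lam(x; k) = √α e^{-i k · x} / |k|^{(d-1)/2}` of the polaron. -/
def polaronFactor {d : ℕ} (α : ℝ) (x k : Position d) : ℂ :=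
  √α * (Complex.exp (-Complex.I * (⟪k, x⟫_ℝ : ℝ)) / (‖k‖ ^ (((d : ℝ) - 1) / 2) : ℝ))

/-- The equation `η + ⟨ψ, Λ ψ⟩ = 0` in `L²(ℝ^d)`, where `Λ(X; k) = ∑_j lam(x_j; k)`. -/
def polaronFieldEq {d N : ℕ} (α : ℝ) (ψ : Wave d N) (η : PhononSpace d) : Prop :=
  ∀ᵐ k, η k + ∫ X, (∑ j, polaronFactor α (particle j X) k) * (‖ψ X‖ ^ 2 : ℝ) = 0

/-! ### The variational problems

In this section `E` is a quasi-classical functional of `ψ` in the normed space `L` and `z` in the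
field space `Z`, with values in the extended reals, and `T : Z → 𝔥` is the change of variables
`η = ω^{1/2} z`. -/

section Variational

variable {L Z 𝔥 : Type*} [NormedAddCommGroup L] [NormedAddCommGroup Z] [InnerProductSpace ℂ Z]
  [NormedAddCommGroup 𝔥] [InnerProductSpace ℂ 𝔥]

/-- The domain of normalized configurations `(ψ, z)` of finite energy. -/
def domQc (E : L → Z → EReal) : Set (L × Z) :=
  {p | ‖p.1‖ = 1 ∧ E p.1 p.2 ≠ ⊤ ∧ E p.1 p.2 ≠ ⊥}

/-- The quasi-classical ground state energy. -/
def energyQc (E : L → Z → EReal) : EReal := ⨅ p ∈ domQc E, E p.1 p.2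

/-- `(ψ, z)` is a minimizer of the quasi-classical functional. -/
def IsQcMinimizer (E : L → Z → EReal) (ψ : L) (z : Z) : Prop :=
  (ψ, z) ∈ domQc E ∧ E ψ z = energyQc E

/-- The functional `𝓕[ψ, η] = 𝓔[ψ, ω^{-1/2} η]`. -/
def fieldFunctional (E : L → Z → EReal) (T : Z ≃ₗᵢ[ℂ] 𝔥) (ψ : L) (η : 𝔥) : EReal :=
  E ψ (T.symm η)

/-- The Pekar functional `inf_{η ∈ 𝔥} 𝓕[ψ, η]`. -/
def pekar (E : L → Z → EReal) (T : Z ≃ₗᵢ[ℂ] 𝔥) (ψ : L) : EReal :=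
  ⨅ η, fieldFunctional E T ψ η

/-- The domain of the Pekar functional. -/
def domPekar (E : L → Z → EReal) (T : Z ≃ₗᵢ[ℂ] 𝔥) : Set L :=
  {ψ | ‖ψ‖ = 1 ∧ pekar E T ψ ≠ ⊤ ∧ pekar E T ψ ≠ ⊥}

/-- The Pekar ground state energy. -/
def energyPekar (E : L → Z → EReal) (T : Z ≃ₗᵢ[ℂ] 𝔥) : EReal :=
  ⨅ ψ ∈ domPekar E T, pekar E T ψ

/-- `ψ` is a minimizer of the Pekar functional. -/
def IsPekarMinimizer (E : L → Z → EReal) (T : Z ≃ₗᵢ[ℂ] 𝔥) (ψ : L) : Prop :=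
  ψ ∈ domPekar E T ∧ pekar E T ψ = energyPekar E T

/-- `𝓕[ψ, ·]` is strictly convex, and `η` is its unique minimizer and the unique solution of the
Euler-Lagrange equation `FieldEq ψ η`; that is, `η = η_Pekar[ψ]`. -/
def IsPekarField (E : L → Z → EReal) (T : Z ≃ₗᵢ[ℂ] 𝔥) (FieldEq : L → 𝔥 → Prop)
    (ψ : L) (η : 𝔥) : Prop :=
  StrictConvexOn ℝ Set.univ (fun η' => (fieldFunctional E T ψ η').toReal) ∧
  (∀ η', FieldEq ψ η' ↔ η' = η) ∧
  (∀ η', fieldFunctional E T ψ η' = pekar E T ψ ↔ η' = η)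

/-- Equivalence of the quasi-classical and the Pekar variational problems: the two ground state
energies coincide and are not `-∞`; the `ψ`-component of a quasi-classical minimizer minimizes the
Pekar functional; every `ψ` in the domain of the Pekar functional has a field `η_Pekar[ψ] ∈ 𝔥`;
and a Pekar minimizer `ψ` together with `z = ω^{-1/2} η_Pekar[ψ]` is a quasi-classical minimizer. -/
def VariationalEquivalence (E : L → Z → EReal) (T : Z ≃ₗᵢ[ℂ] 𝔥) (FieldEq : L → 𝔥 → Prop) :
    Prop :=
  (energyPekar E T = energyQc E ∧ ⊥ < energyQc E) ∧
  (∀ ψ z, IsQcMinimizer E ψ z → IsPekarMinimizer E T ψ) ∧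
  (∀ ψ ∈ domPekar E T, ∃ η, IsPekarField E T FieldEq ψ η) ∧
  (∀ ψ, IsPekarMinimizer E T ψ →
    ∃ η, IsPekarField E T FieldEq ψ η ∧ IsQcMinimizer E ψ (T.symm η))

end Variational

end

/-!
For fixed `ψ` the energy, as a functional of `η = ω^{1/2} z`, is a quadratic polynomial
`K + 2 Re ⟨η, v⟩ + ⟨η, A η⟩ + ‖η‖²` with `A ≥ 0` (and `A = 0` for the Nelson model and the polaron).
It lies above its tangents by `‖·‖²`, hence it is strictly convex, and a minimizer is the same thing
as a solution of `η + A η + v = 0`, which exists by Lax–Milgram. The equivalence of the two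
minimization problems then amounts to the exchange of two infima, and only requires a lower bound.

In the Pauli–Fierz model the energy is nonnegative. Since `∇ · λ = 0`, the imaginary part of the
current `⟨ψ, ξ · (-i∇) ψ⟩`, which is `-½ ∫ ∇|ψ|² · ξ`, vanishes; this identifies the gradient with
the field equation, which does not contain a real part.

For the polaron with `N = 1`, `v(k) = √α |k|^{-(d-1)/2} conj (ρ̂(k))` with
`ρ̂(k) = ∫ e^{i k · x} |ψ|²`. This is square integrable at small `k` because `|ρ̂| ≤ ‖ψ‖²` and
at large `k` because `|k| |ρ̂(k)| ≤ 2 ‖ψ‖ ‖∇ψ‖`. The second bound with a large momentum cutoff also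
yields `‖v‖² ≤ ε ‖∇ψ‖² + C_ε`, hence the lower bound.
-/

/-! ### Strongly convex functionals -/

section StrongGradient

variable {E : Type*} [NormedAddCommGroup E] [InnerProductSpace ℝ E]

/-- `G` is half a (sub)gradient of `f`, and `f` is strongly convex with modulus `m`: `f` lies above
each of its affine supports by `m ‖y - x‖²`. The factor one half makes the identity the strong
gradient of `‖·‖²`; for `m = 0` this is plain convexity. -/
def HasStrongGradient (m : ℝ) (f : E → ℝ) (G : E → E) : Prop :=
  ∀ x y, f x + 2 * ⟪G x, y - x⟫_ℝ + m * ‖y - x‖ ^ 2 ≤ f y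

variable {m : ℝ} {f : E → ℝ} {G : E → E} {x y : E}

theorem hasStrongGradient_quadratic {A : E →L[ℝ] E} (hA : A.IsPositive) (a : ℝ) (b : E) :
    HasStrongGradient 1 (fun x => a + 2 * ⟪x, b⟫_ℝ + ⟪A x, x⟫_ℝ + ‖x‖ ^ 2)
      fun x => x + A x + b := by
  intro x y
  have norm_expand := norm_add_sq_real x (y - x)
  have form_expand : ⟪A (x + (y - x)), x + (y - x)⟫_ℝ =
      ⟪A x, x⟫_ℝ + 2 * ⟪A x, y - x⟫_ℝ + ⟪A (y - x), y - x⟫_ℝ := by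
    have cross : ⟪A (y - x), x⟫_ℝ = ⟪A x, y - x⟫_ℝ := by
      rw [hA.isSymmetric.apply_clm, real_inner_comm]
    simp only [map_add, inner_add_left, inner_add_right, cross]
    ring
  rw [add_sub_cancel] at norm_expand form_expand
  have form_nonneg : 0 ≤ ⟪A (y - x), y - x⟫_ℝ := hA.inner_nonneg_left _
  have linear_expand : ⟪b, y - x⟫_ℝ = ⟪y, b⟫_ℝ - ⟪x, b⟫_ℝ := by
    rw [real_inner_comm, inner_sub_left]
  simp only [inner_add_left, linear_expand]
  linarith

namespace HasStrongGradient

theorem strongConvexOn (h : HasStrongGradient m f G) : StrongConvexOn Set.univ (2 * m) f := by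
  refine ⟨convex_univ, fun x _ y _ a b ha hb hab => ?_⟩
  obtain rfl : b = 1 - a := by linarith
  set w := a • x + (1 - a) • y
  have hx : x - w = (1 - a) • (x - y) := by simp only [w]; module
  have hy : y - w = -a • (x - y) := by simp only [w]; module
  have below_x := mul_le_mul_of_nonneg_left (h w x) ha
  have below_y := mul_le_mul_of_nonneg_left (h w y) hb
  rw [hx, real_inner_smul_right, norm_smul, mul_pow, Real.norm_eq_abs, sq_abs] at below_x
  rw [hy, real_inner_smul_right, norm_smul, mul_pow, Real.norm_eq_abs, sq_abs] at below_y
  simp only [smul_eq_mul]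
  linarith

theorem strictConvexOn (h : HasStrongGradient m f G) (hm : 0 < m) :
    StrictConvexOn ℝ Set.univ f :=
  h.strongConvexOn.strictConvexOn (by positivity)

theorem add_mul_norm_sq_le (h : HasStrongGradient m f G) (hx : G x = 0) (y : E) :
    f x + m * ‖y - x‖ ^ 2 ≤ f y := by
  simpa [hx] using h x y

theorem le_of_eq_zero (h : HasStrongGradient m f G) (hm : 0 ≤ m) (hx : G x = 0) (y : E) :
    f x ≤ f y :=
  (le_add_of_nonneg_right (by positivity)).trans (h.add_mul_norm_sq_le hx y)

theorem eq_of_le (h : HasStrongGradient m f G) (hm : 0 < m) (hx : G x = 0) (hy : f y ≤ f x) :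
    y = x := by
  have hle : m * ‖y - x‖ ^ 2 ≤ 0 := by linarith [h.add_mul_norm_sq_le hx y]
  have hzero : ‖y - x‖ ^ 2 ≤ 0 := nonpos_of_mul_nonpos_right hle hm
  exact sub_eq_zero.1 (norm_eq_zero.1 (pow_eq_zero_iff two_ne_zero |>.1
    (hzero.antisymm (sq_nonneg _))))

theorem eq_of_eq_zero (h : HasStrongGradient m f G) (hm : 0 < m) (hx : G x = 0) (hy : G y = 0) :
    y = x :=
  h.eq_of_le hm hx (h.le_of_eq_zero hm.le hy x)

end HasStrongGradient

theorem exists_add_map_add_eq_zero [CompleteSpace E] (A : E →L[ℝ] E)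
    (hA : ∀ x, 0 ≤ ⟪A x, x⟫_ℝ) (b : E) : ∃ x, x + A x + b = 0 := by
  let B : E →L[ℝ] E →L[ℝ] ℝ := (innerSL ℝ).comp (ContinuousLinearMap.id ℝ E + A)
  have B_apply : ∀ x y, B x y = ⟪x + A x, y⟫_ℝ := fun _ _ => rfl
  have hB : IsCoercive B := by
    refine ⟨1, one_pos, fun x => ?_⟩
    rw [B_apply, inner_add_left, real_inner_self_eq_norm_mul_norm]
    linarith [hA x]
  obtain ⟨x, hx⟩ := hB.continuousLinearEquivOfBilin.surjective (-b)
  refine ⟨x, ?_⟩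
  have : x + A x = hB.continuousLinearEquivOfBilin x :=
    hB.unique_continuousLinearEquivOfBilin fun w => (B_apply x w).symm
  rw [this, hx, neg_add_cancel]

end StrongGradient

section Variational

theorem bot_lt_energyQc {L Z : Type*} [NormedAddCommGroup L] {E : L → Z → EReal} {C : ℝ}
    (hC : ∀ ψ z, ‖ψ‖ = 1 → C ≤ E ψ z) : ⊥ < energyQc E :=
  (EReal.bot_lt_coe C).trans_le (le_iInf₂ fun p hp => hC p.1 p.2 hp.1)

attribute [local instance] InnerProductSpace.complexToReal

variable {L Z 𝔥 : Type*} [NormedAddCommGroup Z] [InnerProductSpace ℂ Z] [NormedAddCommGroup 𝔥]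
  [InnerProductSpace ℂ 𝔥] {E : L → Z → EReal} {T : Z ≃ₗᵢ[ℂ] 𝔥} {FieldEq : L → 𝔥 → Prop} {ψ : L}

theorem fieldFunctional_apply (E : L → Z → EReal) (T : Z ≃ₗᵢ[ℂ] 𝔥) (ψ : L) (z : Z) :
    fieldFunctional E T ψ (T z) = E ψ z := by
  rw [fieldFunctional, T.symm_apply_apply]

theorem pekar_le (E : L → Z → EReal) (T : Z ≃ₗᵢ[ℂ] 𝔥) (ψ : L) (z : Z) : pekar E T ψ ≤ E ψ z :=
  (iInf_le _ (T z)).trans_eq (fieldFunctional_apply E T ψ z)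

theorem isPekarField_of_hasStrongGradient {m : ℝ} (hm : 0 < m) {f : 𝔥 → ℝ} {G : 𝔥 → 𝔥} {η : 𝔥}
    (hf : ∀ η, fieldFunctional E T ψ η = f η) (hG : HasStrongGradient m f G)
    (hF : ∀ η, FieldEq ψ η ↔ G η = 0) (hη : G η = 0) : IsPekarField E T FieldEq ψ η := by
  have pekar_eq : pekar E T ψ = f η := by
    refine le_antisymm ((iInf_le _ η).trans_eq (hf η)) (le_iInf fun η' => ?_)
    rw [hf, EReal.coe_le_coe_iff]
    exact hG.le_of_eq_zero hm.le hη η'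
  refine ⟨?_, fun η' => ?_, fun η' => ?_⟩
  · simpa only [hf, EReal.toReal_coe] using hG.strictConvexOn hm
  · exact (hF η').trans ⟨hG.eq_of_eq_zero hm hη, fun h => h ▸ hη⟩
  · rw [hf, pekar_eq, EReal.coe_eq_coe_iff]
    exact ⟨fun h => hG.eq_of_le hm hη h.le, fun h => h ▸ rfl⟩

variable [NormedAddCommGroup L] {D : Set L} {z : Z} {C : ℝ}

theorem mem_domPekar_of_mem_domQc (hC : ∀ z, C ≤ E ψ z) (h : (ψ, z) ∈ domQc E) :
    ψ ∈ domPekar E T :=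
  ⟨h.1, ((pekar_le E T ψ z).trans_lt h.2.1.lt_top).ne,
    ((EReal.bot_lt_coe C).trans_le (le_iInf fun _ => hC _)).ne'⟩

theorem energyPekar_eq_energyQc (hC : ∀ ψ z, ‖ψ‖ = 1 → C ≤ E ψ z) :
    energyPekar E T = energyQc E := by
  refine le_antisymm (le_iInf₂ fun p hp => ?_) (le_iInf₂ fun ψ hψ => le_iInf fun η => ?_)
  · exact (iInf₂_le p.1 (mem_domPekar_of_mem_domQc (fun z => hC _ z hp.1) hp)).trans
      (pekar_le E T p.1 p.2)
  · by_cases htop : E ψ (T.symm η) = ⊤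
    · exact le_top.trans_eq htop.symm
    · exact iInf₂_le (ψ, T.symm η)
        ⟨hψ.1, htop, ((EReal.bot_lt_coe C).trans_le (hC ψ _ hψ.1)).ne'⟩

theorem IsQcMinimizer.isPekarMinimizer (hC : ∀ ψ z, ‖ψ‖ = 1 → C ≤ E ψ z)
    (h : IsQcMinimizer E ψ z) : IsPekarMinimizer E T ψ := by
  have hψ : ψ ∈ domPekar E T := mem_domPekar_of_mem_domQc (fun z => hC ψ z h.1.1) h.1
  refine ⟨hψ, le_antisymm ?_ (iInf₂_le ψ hψ)⟩
  calc pekar E T ψ ≤ E ψ z := pekar_le E T ψ z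
    _ = energyPekar E T := by rw [energyPekar_eq_energyQc hC, h.2]

theorem IsPekarMinimizer.isQcMinimizer (hC : ∀ ψ z, ‖ψ‖ = 1 → C ≤ E ψ z)
    (h : IsPekarMinimizer E T ψ) {η : 𝔥} (hη : fieldFunctional E T ψ η = pekar E T ψ) :
    IsQcMinimizer E ψ (T.symm η) := by
  change E ψ (T.symm η) = pekar E T ψ at hη
  refine ⟨⟨h.1.1, ?_, ?_⟩, ?_⟩
  · simpa only [hη] using h.1.2.1
  · simpa only [hη] using h.1.2.2
  · rw [hη, h.2, energyPekar_eq_energyQc hC]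

theorem mem_of_mem_domPekar (hD : ∀ ψ ∉ D, ∀ z, E ψ z = ⊤) (h : ψ ∈ domPekar E T) : ψ ∈ D := by
  by_contra hψ
  exact h.2.1 (iInf_eq_top.2 fun _ => hD ψ hψ _)

theorem variationalEquivalence_of_isPekarField (hD : ∀ ψ ∉ D, ∀ z, E ψ z = ⊤)
    (hC : ∀ ψ z, ‖ψ‖ = 1 → C ≤ E ψ z) (hη : ∀ ψ ∈ D, ∃ η, IsPekarField E T FieldEq ψ η) :
    VariationalEquivalence E T FieldEq := by
  refine ⟨⟨energyPekar_eq_energyQc hC, bot_lt_energyQc hC⟩,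
    fun _ _ h => h.isPekarMinimizer hC,
    fun ψ hψ => hη ψ (mem_of_mem_domPekar hD hψ), fun ψ hψ => ?_⟩
  obtain ⟨η, h⟩ := hη ψ (mem_of_mem_domPekar hD hψ.1)
  exact ⟨η, h, hψ.isQcMinimizer hC ((h.2.2 η).2 rfl)⟩

theorem variationalEquivalence_of_quadratic [CompleteSpace 𝔥] (K : L → ℝ) (v : L → 𝔥)
    (A : L → 𝔥 →L[ℝ] 𝔥) (hD : ∀ ψ ∉ D, ∀ z, E ψ z = ⊤)
    (hE : ∀ ψ ∈ D, ∀ z,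
      E ψ z = (K ψ + 2 * ⟪T z, v ψ⟫_ℝ + ⟪A ψ (T z), T z⟫_ℝ + ‖T z‖ ^ 2 : ℝ))
    (hA : ∀ ψ ∈ D, (A ψ).IsPositive) (hC : ∀ ψ z, ‖ψ‖ = 1 → C ≤ E ψ z)
    (hF : ∀ ψ ∈ D, ∀ η, FieldEq ψ η ↔ η + A ψ η + v ψ = 0) :
    VariationalEquivalence E T FieldEq := by
  refine variationalEquivalence_of_isPekarField hD hC fun ψ hψ => ?_
  obtain ⟨η, hη⟩ := exists_add_map_add_eq_zero (A ψ) (hA ψ hψ).inner_nonneg_left (v ψ)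
  refine ⟨η, isPekarField_of_hasStrongGradient one_pos (fun η => ?_)
    (hasStrongGradient_quadratic (hA ψ hψ) (K ψ) (v ψ)) (hF ψ hψ) hη⟩
  rw [fieldFunctional, hE ψ hψ, T.apply_symm_apply]

theorem variationalEquivalence_of_linear [CompleteSpace 𝔥] (K : L → ℝ) (v : L → 𝔥)
    (hD : ∀ ψ ∉ D, ∀ z, E ψ z = ⊤)
    (hE : ∀ ψ ∈ D, ∀ z, E ψ z = (K ψ + 2 * (⟪T z, v ψ⟫_ℂ).re + ‖T z‖ ^ 2 : ℝ))
    (hC : ∀ ψ ∈ D, ‖ψ‖ = 1 → C ≤ K ψ - ‖v ψ‖ ^ 2)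
    (hF : ∀ ψ ∈ D, ∀ η, FieldEq ψ η ↔ η + v ψ = 0) : VariationalEquivalence E T FieldEq := by
  refine variationalEquivalence_of_quadratic (D := D) (C := C) K v (fun _ => 0) hD
    (fun ψ hψ z => ?_) (fun _ _ => ContinuousLinearMap.isPositive_zero)
    (fun ψ z hnorm => ?_) (by simpa using hF)
  · rw [hE ψ hψ, real_inner_eq_re_inner ℂ]
    simp
  · by_cases hψ : ψ ∈ D
    · rw [hE ψ hψ, EReal.coe_le_coe_iff]
      have square : ‖T z + v ψ‖ ^ 2 = ‖T z‖ ^ 2 + 2 * (⟪T z, v ψ⟫_ℂ).re + ‖v ψ‖ ^ 2 :=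
        norm_add_sq (𝕜 := ℂ) _ _
      linarith [hC ψ hψ hnorm, sq_nonneg ‖T z + v ψ‖]
    · exact le_top.trans_eq (hD ψ hψ z).symm

end Variational

section Configurations

variable {d N : ℕ}

/-- The coordinates of all particles but the `j`-th one. -/
abbrev Others (d : ℕ) {N : ℕ} (j : Fin N) : Type := {i : Fin N × Fin d // ¬ i.1 = j} → ℝ

theorem continuous_particle (j : Fin N) : Continuous (particle (d := d) j) := by
  unfold particle
  fun_prop

/-- The splitting of a configuration into the position of the `j`-th particle and the remaining
coordinates, read from right to left. -/
noncomputable def assemble (j : Fin N) : Position d × Others d j ≃ᵐ Config d N where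
  toFun p := WithLp.toLp 2 fun i => if h : i.1 = j then p.1 i.2 else p.2 ⟨i, h⟩
  invFun X := (particle j X, fun i => X i.1)
  left_inv p := by
    refine Prod.ext ?_ (funext fun i => ?_)
    · ext ℓ
      simp [particle]
    · simp [i.2]
  right_inv X := by
    ext ⟨i, ℓ⟩
    by_cases h : i = j
    · subst h
      simp [particle]
    · simp [h]
  measurable_toFun := by
    refine (WithLp.measurable_toLp 2 _).comp (measurable_pi_lambda _ fun i => ?_)
    by_cases h : i.1 = j <;> simp only [h, dite_true, dite_false] <;> fun_prop
  measurable_invFun := (continuous_particle j).measurable.prodMk (by fun_prop)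

theorem assemble_apply (j : Fin N) (p : Position d × Others d j) (i : Fin N × Fin d) :
    assemble j p i = if h : i.1 = j then p.1 i.2 else p.2 ⟨i, h⟩ :=
  rfl

theorem particle_assemble (j : Fin N) (p : Position d × Others d j) :
    particle j (assemble j p) = p.1 :=
  congrArg Prod.fst ((assemble j).symm_apply_apply p)

/-- The coordinates of the `j`-th particle among all coordinates. -/
def particleCoord (d : ℕ) (j : Fin N) : Fin d ≃ {i : Fin N × Fin d // i.1 = j} where
  toFun ℓ := ⟨(j, ℓ), rfl⟩
  invFun i := i.1.2
  left_inv _ := rfl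
  right_inv := by rintro ⟨⟨i, ℓ⟩, rfl⟩; rfl

theorem measurePreserving_assemble (j : Fin N) : MeasurePreserving (assemble (d := d) j) := by
  have reindex : MeasurePreserving fun x : Position d =>
      (fun i => x i.1.2 : {i : Fin N × Fin d // i.1 = j} → ℝ) := by
    refine ((volume_measurePreserving_piCongrLeft (fun _ => ℝ)
      (particleCoord d j)).comp (PiLp.volume_preserving_ofLp (Fin d))).congr (by fun_prop)
      (.of_forall fun x => funext fun i => ?_)
    obtain ⟨ℓ, rfl⟩ := (particleCoord d j).surjective i
    exact MeasurableEquiv.piCongrLeft_apply_apply (β := fun _ => ℝ) (particleCoord d j) x.ofLp ℓ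
  have join := (volume_preserving_piEquivPiSubtypeProd (fun _ => ℝ)
    fun i : Fin N × Fin d => i.1 = j).symm
  exact (PiLp.volume_preserving_toLp (Fin N × Fin d)).comp
    (join.comp (reindex.prod (MeasurePreserving.id (volume : Measure (Others d j)))))

theorem quasiMeasurePreserving_particle (j : Fin N) :
    Measure.QuasiMeasurePreserving (particle (d := d) j) :=
  Measure.quasiMeasurePreserving_fst.comp
    (measurePreserving_assemble j).symm.quasiMeasurePreserving

/-- The displacement of the `j`-th particle, as a linear map. -/
noncomputable def displace (j : Fin N) : Position d →L[ℝ] Config d N :=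
  LinearMap.toContinuousLinearMap
    { toFun := fun x => assemble j (x, 0)
      map_add' := fun x x' => by
        ext i
        by_cases h : i.1 = j <;> simp [assemble_apply, h]
      map_smul' := fun t x => by
        ext i
        by_cases h : i.1 = j <;> simp [assemble_apply, h] }

theorem assemble_eq_displace_add (j : Fin N) (x : Position d) (y : Others d j) :
    assemble j (x, y) = displace j x + assemble j (0, y) := by
  ext i
  by_cases h : i.1 = j <;> simp [displace, assemble_apply, h]

theorem displace_single (j : Fin N) (ℓ : Fin d) :
    displace j (EuclideanSpace.single ℓ 1) = EuclideanSpace.single (j, ℓ) (1 : ℝ) := by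
  ext ⟨i, k⟩
  by_cases h : i = j <;> simp [displace, assemble_apply, h, PiLp.single_apply]

end Configurations

section BoundedMultipliers

variable {α β F : Type*} [MeasurableSpace α] [MeasurableSpace β] {μ : Measure α} {ν : Measure β}
  [NormedAddCommGroup F]

theorem exists_ae_norm_le_of_memLp_top {f : α → F} (hf : MemLp f ⊤ μ) :
    ∃ C, 0 ≤ C ∧ ∀ᵐ x ∂μ, ‖f x‖ ≤ C := by
  refine ⟨(eLpNormEssSup f μ).toReal, ENNReal.toReal_nonneg, ?_⟩
  filter_upwards [ae_le_eLpNormEssSup (f := f) (μ := μ)] with x hx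
  rw [← toReal_enorm]
  exact ENNReal.toReal_mono (eLpNorm_exponent_top (f := f) (μ := μ) ▸ hf.2.ne) hx

theorem memLp_top_comp_quasiMeasurePreserving {f : β → F} (hf : MemLp f ⊤ ν) {g : α → β}
    (hg : Measure.QuasiMeasurePreserving g μ ν) : MemLp (fun x => f (g x)) ⊤ μ := by
  obtain ⟨C, -, hC⟩ := exists_ae_norm_le_of_memLp_top hf
  exact memLp_top_of_bound (hf.1.comp_quasiMeasurePreserving hg) C (hg.ae hC)

theorem integrable_norm_sq (f : Lp F 2 μ) : Integrable (fun x => ‖f x‖ ^ 2) μ :=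
  (Lp.memLp f).integrable_norm_pow two_ne_zero

theorem integral_norm_sq (f : Lp F 2 μ) : ∫ x, ‖f x‖ ^ 2 ∂μ = ‖f‖ ^ 2 := by
  rw [Lp.norm_def, (Lp.memLp f).eLpNorm_eq_integral_rpow_norm two_ne_zero ENNReal.ofNat_ne_top,
    ENNReal.toReal_ofReal (by positivity), ← Real.rpow_natCast, ← Real.rpow_mul (by positivity)]
  simp

theorem norm_integral_norm_sq_smul_le [NormedSpace ℝ F] {h : α → F} {C : ℝ}
    (hh : ∀ᵐ x ∂μ, ‖h x‖ ≤ C) (f : Lp ℂ 2 μ) : ‖∫ x, (‖f x‖ ^ 2) • h x ∂μ‖ ≤ C * ‖f‖ ^ 2 := by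
  calc ‖∫ x, (‖f x‖ ^ 2) • h x ∂μ‖ ≤ ∫ x, C * ‖f x‖ ^ 2 ∂μ := by
        refine norm_integral_le_of_norm_le ((integrable_norm_sq f).const_mul C) ?_
        filter_upwards [hh] with x hx
        rw [norm_smul, Real.norm_of_nonneg (by positivity), mul_comm]
        gcongr
    _ = C * ‖f‖ ^ 2 := by rw [integral_const_mul, integral_norm_sq]

theorem continuous_integral_inner_smul {G : Type*} [NormedAddCommGroup G] [InnerProductSpace ℝ G]
    [NormedSpace ℝ F] [CompleteSpace F] {h : α → F} (hh : MemLp h ⊤ μ) :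
    Continuous fun p : Lp G 2 μ × Lp G 2 μ => ∫ x, ⟪p.1 x, p.2 x⟫_ℝ • h x ∂μ := by
  let product := (innerSL ℝ : G →L[ℝ] G →L[ℝ] ℝ).holderL μ 2 2 1
  let pairing := (ContinuousLinearMap.lsmul ℝ ℝ : ℝ →L[ℝ] F →L[ℝ] F).lpPairing μ 1 ⊤
  have pairing_eq : ∀ p : Lp G 2 μ × Lp G 2 μ,
      ∫ x, ⟪p.1 x, p.2 x⟫_ℝ • h x ∂μ = pairing (product p.1 p.2) (hh.toLp h) := by
    intro p
    rw [ContinuousLinearMap.lpPairing_eq_integral]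
    refine integral_congr_ae ?_
    filter_upwards [(innerSL ℝ : G →L[ℝ] G →L[ℝ] ℝ).coeFn_holder p.1 p.2 (r := 1),
      hh.coeFn_toLp] with x hx hx'
    rw [hx']
    exact congrArg (· • h x) hx.symm
  simp only [pairing_eq]
  fun_prop

end BoundedMultipliers

/-! ### The Nelson model -/

theorem sum_norm_momentum_sq_le_freeForm {d N : ℕ} {W : Config d N → ℝ} (hW : ∀ᵐ X, 0 ≤ W X)
    (ψ : Wave d N) : ∑ j, ∑ ℓ, ‖momentum ψ j ℓ‖ ^ 2 ≤ freeForm W ψ := by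
  refine le_add_of_nonneg_right (integral_nonneg_of_ae ?_)
  filter_upwards [hW] with X hX
  positivity

theorem freeForm_nonneg {d N : ℕ} {W : Config d N → ℝ} (hW : ∀ᵐ X, 0 ≤ W X) (ψ : Wave d N) :
    0 ≤ freeForm W ψ := by
  refine le_trans ?_ (sum_norm_momentum_sq_le_freeForm hW ψ)
  positivity

section Nelson

variable {𝔥 : Type*} [NormedAddCommGroup 𝔥] [InnerProductSpace ℂ 𝔥] [CompleteSpace 𝔥]

theorem re_inner_integral_norm_sq_smul {α : Type*} [MeasurableSpace α] {μ : Measure α}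
    {Λ : α → 𝔥} (hΛ : MemLp Λ ⊤ μ) (f : Lp ℂ 2 μ) (η : 𝔥) :
    (⟪η, ∫ x, (‖f x‖ ^ 2) • Λ x ∂μ⟫_ℂ).re = ∫ x, (⟪η, Λ x⟫_ℂ).re * ‖f x‖ ^ 2 ∂μ := by
  have hint : Integrable (fun x => (‖f x‖ ^ 2) • Λ x) μ :=
    (integrable_norm_sq f).smul_of_top_left hΛ
  calc (⟪η, ∫ x, (‖f x‖ ^ 2) • Λ x ∂μ⟫_ℂ).re
      = (∫ x, ⟪η, (‖f x‖ ^ 2) • Λ x⟫_ℂ ∂μ).re := by rw [integral_inner hint η]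
    _ = ∫ x, (⟪η, (‖f x‖ ^ 2) • Λ x⟫_ℂ).re ∂μ :=
        (integral_re (𝕜 := ℂ) (hint.const_inner (𝕜 := ℂ) η)).symm
    _ = ∫ x, (⟪η, Λ x⟫_ℂ).re * ‖f x‖ ^ 2 ∂μ := by
        simp only [inner_smul_right_eq_smul, Complex.smul_re, smul_eq_mul, mul_comm]

variable {d N : ℕ} {W : Config d N → ℝ} {ω : Dispersion 𝔥} {lam : Position d → 𝔥}

/-- The vector `⟨ψ, Λ ψ⟩` of `nelsonFieldEq`, i.e. the source of the classical field. -/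
noncomputable def nelsonSource (ω : Dispersion 𝔥) (lam : Position d → 𝔥) (ψ : Wave d N) : 𝔥 :=
  ∫ X, (‖ψ X‖ ^ 2) • ∑ j, ω.negHalfApply (lam (particle j X))

theorem memLp_top_sum_particle (hlam : MemLp (fun x => ω.negHalfApply (lam x)) ⊤) :
    MemLp (fun X : Config d N => ∑ j, ω.negHalfApply (lam (particle j X))) ⊤ :=
  memLp_finsetSum _ fun j _ =>
    memLp_top_comp_quasiMeasurePreserving hlam (quasiMeasurePreserving_particle j)

theorem nelsonEnergy_of_mem (hlam : MemLp (fun x => ω.negHalfApply (lam x)) ⊤) {ψ : Wave d N}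
    (hψ : ψ ∈ formDomain W) (z : ω.FieldSpace) :
    nelsonEnergy ω lam W ψ z = (freeForm W ψ + 2 * (⟪ω.halfIso z, nelsonSource ω lam ψ⟫_ℂ).re
      + ‖ω.halfIso z‖ ^ 2 : ℝ) := by
  have interaction : ∫ X, (∑ j, 2 * (ω.pairing z (lam (particle j X))).re) * ‖ψ X‖ ^ 2
      = 2 * (⟪ω.halfIso z, nelsonSource ω lam ψ⟫_ℂ).re := by
    rw [nelsonSource, re_inner_integral_norm_sq_smul (memLp_top_sum_particle hlam),
      ← integral_const_mul]
    simp only [Dispersion.pairing, inner_sum, Complex.re_sum, Finset.mul_sum, Finset.sum_mul,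
      mul_assoc]
  simp only [nelsonEnergy, hψ, if_true, interaction, LinearIsometryEquiv.norm_map]

theorem nelson_variationalEquivalence (hW : ∀ᵐ X, 0 ≤ W X)
    (hlam : MemLp (fun x => ω.negHalfApply (lam x)) ⊤) :
    VariationalEquivalence (nelsonEnergy ω lam W) ω.halfIso (nelsonFieldEq ω lam) := by
  obtain ⟨C, -, hC⟩ := exists_ae_norm_le_of_memLp_top (memLp_top_sum_particle (N := N) hlam)
  refine variationalEquivalence_of_linear (D := formDomain W) (C := -C ^ 2) (freeForm W)
    (nelsonSource ω lam) (fun ψ hψ z => by simp [nelsonEnergy, hψ])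
    (fun ψ hψ z => nelsonEnergy_of_mem hlam hψ z) (fun ψ _ hnorm => ?_) fun _ _ _ => Iff.rfl
  have source_le : ‖nelsonSource ω lam ψ‖ ≤ C := by
    simpa [nelsonSource, hnorm] using norm_integral_norm_sq_smul_le hC ψ
  have source_sq_le := pow_le_pow_left₀ (norm_nonneg _) source_le 2
  linarith only [source_sq_le, freeForm_nonneg hW ψ]

end Nelson

section Sobolev

open TemperedDistribution Filter Topology

variable {E F : Type*} [NormedAddCommGroup E] [InnerProductSpace ℝ E] [FiniteDimensional ℝ E]
  [MeasurableSpace E] [BorelSpace E] [NormedAddCommGroup F] [InnerProductSpace ℂ F]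

theorem exists_schwartz_tendsto (f : Lp F 2 (volume : Measure E)) :
    ∃ χ : ℕ → 𝓢(E, F), Tendsto (fun n => (χ n).toLp 2) atTop (𝓝 f) := by
  have dense := SchwartzMap.denseRange_toLpCLM (E := E) (F := F) (p := 2) (by norm_num)
    (μ := (volume : Measure E))
  obtain ⟨u, hu, hlim⟩ := mem_closure_iff_seq_limit.1 (dense f)
  choose χ hχ using hu
  exact ⟨χ, hlim.congr fun n => (hχ n).symm⟩

variable [CompleteSpace F]

theorem lineDeriv_toLp (φ : 𝓢(E, F)) (m : E) :
    ∂_{m} (φ.toLp 2 (volume : Measure E) : 𝓢'(E, F)) =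
      ((∂_{m} φ).toLp 2 (volume : Measure E) : 𝓢'(E, F)) := by
  rw [Lp.toTemperedDistribution_toLp_eq, Lp.toTemperedDistribution_toLp_eq,
    lineDerivOp_toTemperedDistributionCLM_eq]

theorem toTemperedDistribution_injective {f g : Lp F 2 (volume : Measure E)}
    (h : (f : 𝓢'(E, F)) = (g : 𝓢'(E, F))) : f = g :=
  LinearMap.ker_eq_bot.1
    (Lp.ker_toTemperedDistributionCLM_eq_bot (F := F) (μ := (volume : Measure E)) (p := 2)) h

theorem exists_continuousLinearMap_of_forall_mem_lp (T : 𝓢'(E, F) →L[ℂ] 𝓢'(E, F))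
    (hT : ∀ f : Lp F 2 (volume : Measure E), ∃ g : Lp F 2 (volume : Measure E),
      T (f : 𝓢'(E, F)) = (g : 𝓢'(E, F))) :
    ∃ M : Lp F 2 (volume : Measure E) →L[ℂ] Lp F 2 (volume : Measure E),
      ∀ f, ((M f : Lp F 2 (volume : Measure E)) : 𝓢'(E, F)) = T (f : 𝓢'(E, F)) := by
  let ι := Lp.toTemperedDistributionCLM F (volume : Measure E) 2
  have ι_injective : Function.Injective ι := fun _ _ => toTemperedDistribution_injective
  let M := (LinearEquiv.ofInjective ι.toLinearMap ι_injective).symm.toLinearMap.comp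
    ((T.comp ι).toLinearMap.codRestrict ι.toLinearMap.range fun f => (hT f).imp fun _ => Eq.symm)
  have hM : ∀ f, ι (M f) = T (ι f) := fun f =>
    congrArg Subtype.val ((LinearEquiv.ofInjective ι.toLinearMap ι_injective).apply_symm_apply _)
  refine ⟨⟨M, M.continuous_of_seq_closed_graph fun u f g hu hMu => ι_injective ?_⟩, hM⟩
  have along_u : Tendsto (fun n => T (ι (u n))) atTop (𝓝 (T (ι f))) :=
    ((T.continuous.comp ι.continuous).tendsto f).comp hu
  have along_Mu : Tendsto (fun n => T (ι (u n))) atTop (𝓝 (ι g)) :=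
    ((ι.continuous.tendsto g).comp hMu).congr fun n => hM (u n)
  exact (tendsto_nhds_unique along_Mu along_u).trans (hM f).symm

theorem memSobolev_one_besselPotential (f : Lp F 2 (volume : Measure E)) :
    MemSobolev 1 2 (besselPotential E F (-1) (f : 𝓢'(E, F))) := by
  rw [memSobolev_besselPotential_iff, neg_add_cancel, memSobolev_zero_iff]
  exact ⟨f, rfl⟩

theorem exists_schwartz_approximation {ψ : Lp F 2 (volume : Measure E)}
    (hψ : MemSobolev 1 2 (ψ : 𝓢'(E, F))) :
    ∃ φ : ℕ → 𝓢(E, F), Tendsto (fun n => (φ n).toLp 2) atTop (𝓝 ψ) ∧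
      ∀ m : E, ∃ g : Lp F 2 (volume : Measure E), ∂_{m} (ψ : 𝓢'(E, F)) = (g : 𝓢'(E, F)) ∧
        Tendsto (fun n => (∂_{m} (φ n)).toLp 2) atTop (𝓝 g) := by
  obtain ⟨f, hf⟩ := hψ
  obtain ⟨χ, hχ⟩ := exists_schwartz_tendsto f
  obtain ⟨M, hM⟩ := exists_continuousLinearMap_of_forall_mem_lp (besselPotential E F (-1))
    fun v => memSobolev_zero_iff.1 ((memSobolev_one_besselPotential v).mono zero_le_one)
  let J : 𝓢(E, F) →L[ℂ] 𝓢(E, F) :=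
    SchwartzMap.fourierMultiplierCLM F fun x : E => (((1 + ‖x‖ ^ 2) ^ (-1 / 2 : ℝ) : ℝ) : ℂ)
  have J_eq : ∀ φ, ((J φ).toLp 2 (volume : Measure E) : 𝓢'(E, F)) =
      besselPotential E F (-1) (φ.toLp 2 (volume : Measure E) : 𝓢'(E, F)) := by
    intro φ
    rw [Lp.toTemperedDistribution_toLp_eq, Lp.toTemperedDistribution_toLp_eq, besselPotential,
      fourierMultiplierCLM_toTemperedDistributionCLM_eq (by fun_prop)]
  have hψ : besselPotential E F (-1) (f : 𝓢'(E, F)) = ψ :=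
    (besselPotential_neg_apply_eq_iff 1 _ _).2 hf
  refine ⟨fun n => J (χ n), ?_, fun m => ?_⟩
  · have M_f : M f = ψ := toTemperedDistribution_injective ((hM f).trans hψ)
    rw [← M_f]
    refine ((M.continuous.tendsto f).comp hχ).congr fun n => ?_
    exact toTemperedDistribution_injective ((hM _).trans (J_eq _).symm)
  · obtain ⟨M', hM'⟩ := exists_continuousLinearMap_of_forall_mem_lp
      ((LineDeriv.lineDerivOpCLM ℂ 𝓢'(E, F) m).comp (besselPotential E F (-1)))
      fun v => memSobolev_zero_iff.1
        (by simpa using (memSobolev_one_besselPotential v).lineDerivOp (m := m))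
    refine ⟨M' f, (congrArg (∂_{m} ·) hψ).symm.trans (hM' f).symm, ?_⟩
    refine ((M'.continuous.tendsto f).comp hχ).congr fun n => ?_
    refine toTemperedDistribution_injective ((hM' _).trans ?_)
    exact (congrArg (∂_{m} ·) (J_eq (χ n))).symm.trans (lineDeriv_toLp (J (χ n)) m)

end Sobolev

section Density

open Filter Topology

section Schwartz

variable {E G : Type*} [NormedAddCommGroup E] [NormedSpace ℝ E] [NormedAddCommGroup G]
  [InnerProductSpace ℝ G]

theorem fderiv_norm_sq_schwartz (φ : 𝓢(E, G)) (x m : E) :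
    fderiv ℝ (fun y => ‖φ y‖ ^ 2) x m = 2 * ⟪φ x, ∂_{m} φ x⟫_ℝ := by
  rw [(φ.hasFDerivAt x).norm_sq.fderiv, SchwartzMap.lineDerivOp_apply_eq_fderiv]
  simp [two_mul]

variable [MeasurableSpace E] [BorelSpace E] [SecondCountableTopology E] {μ : Measure E}
  [μ.HasTemperateGrowth]

theorem integrable_inner_schwartz (φ χ : 𝓢(E, G)) : Integrable (fun x => ⟪φ x, χ x⟫_ℝ) μ := by
  refine (L2.integrable_inner (𝕜 := ℝ) (φ.toLp 2 μ) (χ.toLp 2 μ)).congr ?_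
  filter_upwards [φ.coeFn_toLp 2 μ, χ.coeFn_toLp 2 μ] with x hφ hχ
  rw [hφ, hχ]

theorem integrable_norm_sq_schwartz (φ : 𝓢(E, G)) : Integrable (fun x => ‖φ x‖ ^ 2) μ := by
  simpa only [real_inner_self_eq_norm_sq] using integrable_inner_schwartz φ φ

theorem integrable_fderiv_norm_sq_schwartz (φ : 𝓢(E, G)) (m : E) :
    Integrable (fun x => fderiv ℝ (fun y => ‖φ y‖ ^ 2) x m) μ := by
  simpa only [fderiv_norm_sq_schwartz] using (integrable_inner_schwartz φ (∂_{m} φ)).const_mul 2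

end Schwartz

variable {d N : ℕ} {ψ : Wave d N}

theorem momentum_eq_of_hasWeakPartial {g : Wave d N} {j : Fin N} {ℓ : Fin d}
    (h : HasWeakPartial ψ j ℓ g) : momentum ψ j ℓ = (-Complex.I) • g := by
  have hex : ∃ g, HasWeakPartial ψ j ℓ g := ⟨g, h⟩
  rw [momentum, dif_pos hex]
  congr 1
  exact toTemperedDistribution_injective (hex.choose_spec.symm.trans h)

theorem InH1.exists_approximation (hψ : InH1 ψ) :
    ∃ φ : ℕ → 𝓢(Config d N, ℂ), Tendsto (fun n => (φ n).toLp 2) atTop (𝓝 ψ) ∧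
      ∀ j ℓ, Tendsto (fun n =>
        (∂_{(EuclideanSpace.single (j, ℓ) (1 : ℝ) : Config d N)} (φ n)).toLp 2) atTop
          (𝓝 (Complex.I • momentum ψ j ℓ)) := by
  obtain ⟨φ, hφ, hderiv⟩ := exists_schwartz_approximation hψ
  refine ⟨φ, hφ, fun j ℓ => ?_⟩
  obtain ⟨g, hg, hlim⟩ := hderiv (EuclideanSpace.single (j, ℓ) 1)
  rw [momentum_eq_of_hasWeakPartial hg, smul_smul]
  simpa using hlim

/-- The derivative `∂_{j,ℓ} |ψ|²` of the density, expressed by the momentum: `∂ψ = i (-i ∂ψ)`. -/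
noncomputable def densityDeriv (ψ : Wave d N) (j : Fin N) (ℓ : Fin d) (X : Config d N) : ℝ :=
  2 * ⟪ψ X, Complex.I * momentum ψ j ℓ X⟫_ℝ

theorem densityDeriv_ae_eq (ψ : Wave d N) (j : Fin N) (ℓ : Fin d) :
    densityDeriv ψ j ℓ =ᵐ[volume] fun X => 2 * ⟪ψ X, (Complex.I • momentum ψ j ℓ) X⟫_ℝ := by
  filter_upwards [Lp.coeFn_smul Complex.I (momentum ψ j ℓ)] with X hX
  simp only [densityDeriv, hX, Pi.smul_apply, smul_eq_mul]

theorem integrable_densityDeriv (ψ : Wave d N) (j : Fin N) (ℓ : Fin d) :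
    Integrable (densityDeriv ψ j ℓ) :=
  ((L2.integrable_inner (𝕜 := ℝ) ψ (Complex.I • momentum ψ j ℓ)).const_mul 2).congr
    (densityDeriv_ae_eq ψ j ℓ).symm

variable {F : Type*} [NormedAddCommGroup F] [NormedSpace ℝ F] [CompleteSpace F]

theorem InH1.sum_integral_densityDeriv_smul (hψ : InH1 ψ) (j : Fin N) (s : Finset (Fin d))
    {h : Fin d → Config d N → F} (hh : ∀ ℓ, MemLp (h ℓ) ⊤) {b : Config d N → F} (hb : MemLp b ⊤)
    (hschwartz : ∀ φ : 𝓢(Config d N, ℂ), ∑ ℓ ∈ s, ∫ X,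
      (fderiv ℝ (fun Y => ‖φ Y‖ ^ 2) X (EuclideanSpace.single (j, ℓ) 1)) • h ℓ X =
        ∫ X, (‖φ X‖ ^ 2) • b X) :
    ∑ ℓ ∈ s, ∫ X, densityDeriv ψ j ℓ X • h ℓ X = ∫ X, (‖ψ X‖ ^ 2) • b X := by
  obtain ⟨φ, hφ, hderiv⟩ := hψ.exists_approximation
  have lhs_tendsto := tendsto_finsetSum s fun ℓ _ =>
    (((continuous_integral_inner_smul (hh ℓ)).tendsto (ψ, _)).comp
      (hφ.prodMk_nhds (hderiv j ℓ))).const_smul (2 : ℝ)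
  have rhs_tendsto := ((continuous_integral_inner_smul hb).tendsto (ψ, ψ)).comp
    (hφ.prodMk_nhds hφ)
  have limits_eq := tendsto_nhds_unique (lhs_tendsto.congr fun n => ?_) rhs_tendsto
  · simp only [real_inner_self_eq_norm_sq, ← integral_smul, smul_smul] at limits_eq
    rw [← limits_eq]
    refine Finset.sum_congr rfl fun ℓ _ => integral_congr_ae ?_
    filter_upwards [densityDeriv_ae_eq ψ j ℓ] with X hX
    rw [hX]
  · have hcoe := (φ n).coeFn_toLp 2 (volume : Measure (Config d N))
    simp only [Function.comp_apply, real_inner_self_eq_norm_sq, ← integral_smul, smul_smul]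
    calc _ = ∑ ℓ ∈ s, ∫ X,
          (fderiv ℝ (fun Y => ‖φ n Y‖ ^ 2) X (EuclideanSpace.single (j, ℓ) 1)) • h ℓ X := by
          refine Finset.sum_congr rfl fun ℓ _ => integral_congr_ae ?_
          filter_upwards [hcoe, (∂_{(EuclideanSpace.single (j, ℓ) (1 : ℝ) : Config d N)}
            (φ n)).coeFn_toLp 2 (volume : Measure (Config d N))] with X hX hX'
          rw [hX, hX', fderiv_norm_sq_schwartz]
      _ = ∫ X, (‖φ n X‖ ^ 2) • b X := hschwartz (φ n)
      _ = _ := by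
          refine integral_congr_ae ?_
          filter_upwards [hcoe] with X hX
          rw [hX]

end Density

/-! ### Divergence-free fields -/

section DivergenceFree

open Filter Topology

theorem exists_smooth_cutoff (E : Type*) [NormedAddCommGroup E] [NormedSpace ℝ E]
    [FiniteDimensional ℝ E] :
    ∃ (c : ℕ → E → ℝ) (K : ℝ), (∀ n, ContDiff ℝ ((⊤ : ℕ∞) : WithTop ℕ∞) (c n)) ∧
      (∀ n, HasCompactSupport (c n)) ∧ (∀ n x, ‖c n x‖ ≤ 1) ∧
      (∀ n x, ‖fderiv ℝ (c n) x‖ ≤ K) ∧ ∀ x, ∀ᶠ n in atTop, c n =ᶠ[𝓝 x] fun _ => 1 := by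
  let χ : ContDiffBump (0 : E) := ⟨1, 2, one_pos, one_lt_two⟩
  have hχ : ContDiff ℝ ((⊤ : ℕ∞) : WithTop ℕ∞) χ := χ.contDiff
  obtain ⟨K, hK⟩ := (hχ.continuous_fderiv (by simp)).bounded_above_of_compact_support
    (χ.hasCompactSupport.fderiv ℝ)
  let t : ℕ → ℝ := fun n => 1 / ((n : ℝ) + 1)
  have t_pos : ∀ n, 0 < t n := fun n => by positivity
  have t_le_one : ∀ n, t n ≤ 1 := fun n =>
    (div_le_one (by positivity)).2 (by linarith [Nat.cast_nonneg (α := ℝ) n])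
  refine ⟨fun n x => χ (t n • x), K, fun n => hχ.comp (contDiff_const_smul (t n)),
    fun n => χ.hasCompactSupport.comp_smul (t_pos n).ne', fun n x => ?_, fun n x => ?_,
    fun x => ?_⟩
  · rw [Real.norm_of_nonneg χ.nonneg]
    exact χ.le_one
  · rw [fderiv_comp_smul, norm_smul, Real.norm_of_nonneg (t_pos n).le]
    exact (mul_le_of_le_one_left (norm_nonneg _) (t_le_one n)).trans (hK _)
  · have scaled : Tendsto (fun n => t n • x) atTop (𝓝 0) := by
      simpa only [zero_smul] using (tendsto_one_div_add_atTop_nhds_zero_nat (𝕜 := ℝ)).smul_const x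
    filter_upwards [scaled.eventually χ.eventuallyEq_one.eventually_nhds] with n hn
    exact ((continuous_id.const_smul (t n)).tendsto x).eventually hn

variable {ι E F : Type*} [Fintype ι] [NormedAddCommGroup E] [NormedSpace ℝ E] [MeasurableSpace E]
  [NormedAddCommGroup F] [NormedSpace ℝ F]

/-- The field `∑ ℓ, h ℓ • v ℓ` has vanishing distributional divergence with respect to `μ`. -/
def IsWeaklyDivergenceFree (v : ι → E) (h : ι → E → F) (μ : Measure E) : Prop :=
  ∀ ρ : E → ℝ, ContDiff ℝ ((⊤ : ℕ∞) : WithTop ℕ∞) ρ → HasCompactSupport ρ →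
    ∫ x, ∑ ℓ, fderiv ℝ ρ x (v ℓ) • h ℓ x ∂μ = 0

theorem integrable_fderiv_smul [OpensMeasurableSpace E] {μ : Measure E}
    [IsFiniteMeasureOnCompacts μ] {ρ : E → ℝ} (hρ : ContDiff ℝ ((⊤ : ℕ∞) : WithTop ℕ∞) ρ)
    (hc : HasCompactSupport ρ) (v : E) {h : E → F} (hh : MemLp h ⊤ μ) :
    Integrable (fun x => fderiv ℝ ρ x v • h x) μ :=
  (Continuous.integrable_of_hasCompactSupport
    ((hρ.continuous_fderiv (by simp)).clm_apply continuous_const)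
    (hc.fderiv_apply ℝ v)).smul_of_top_left hh

theorem IsWeaklyDivergenceFree.integral_eq_zero [FiniteDimensional ℝ E] [BorelSpace E]
    {v : ι → E} {h : ι → E → F} {μ : Measure E} (hdiv : IsWeaklyDivergenceFree v h μ)
    (hh : ∀ ℓ, MemLp (h ℓ) ⊤ μ) {ρ : E → ℝ} (hρ : ContDiff ℝ ((⊤ : ℕ∞) : WithTop ℕ∞) ρ)
    (hi : Integrable ρ μ) (hi' : ∀ ℓ, Integrable (fun x => fderiv ℝ ρ x (v ℓ)) μ) :
    ∫ x, ∑ ℓ, fderiv ℝ ρ x (v ℓ) • h ℓ x ∂μ = 0 := by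
  obtain ⟨c, K, c_smooth, c_compact, c_le, c_fderiv_le, c_eq⟩ := exists_smooth_cutoff E
  have K_nonneg : 0 ≤ K := (norm_nonneg _).trans (c_fderiv_le 0 0)
  choose B _ hB using fun ℓ => exists_ae_norm_le_of_memLp_top (hh ℓ)
  have fderiv_cutoff_le : ∀ n x w, ‖fderiv ℝ (fun y => c n y * ρ y) x w‖ ≤
      ‖fderiv ℝ ρ x w‖ + ‖ρ x‖ * (K * ‖w‖) := fun n x w => by
    rw [fderiv_fun_mul ((c_smooth n).differentiable (by simp) x) (hρ.differentiable (by simp) x)]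
    refine (norm_add_le _ _).trans (add_le_add ?_ ?_)
    · exact (norm_mul_le _ _).trans (mul_le_of_le_one_left (norm_nonneg _) (c_le n x))
    · refine (norm_mul_le _ _).trans (mul_le_mul_of_nonneg_left ?_ (norm_nonneg _))
      exact (ContinuousLinearMap.le_opNorm _ _).trans (by gcongr; exact c_fderiv_le n x)
  refine tendsto_nhds_unique (tendsto_integral_of_dominated_convergence
    (F := fun n x => ∑ ℓ, fderiv ℝ (fun y => c n y * ρ y) x (v ℓ) • h ℓ x)
    (fun x => ∑ ℓ, (‖fderiv ℝ ρ x (v ℓ)‖ + ‖ρ x‖ * (K * ‖v ℓ‖)) * B ℓ) (fun n => ?_) ?_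
    (fun n => ?_) (.of_forall fun x => ?_)) (tendsto_const_nhds.congr fun n =>
      (hdiv _ ((c_smooth n).mul hρ) (c_compact n).mul_right).symm)
  · refine Finset.aestronglyMeasurable_fun_sum _ fun ℓ _ => .smul ?_ (hh ℓ).1
    exact ((((c_smooth n).mul hρ).continuous_fderiv (by simp)).clm_apply
      continuous_const).aestronglyMeasurable
  · exact integrable_finsetSum _ fun ℓ _ =>
      ((hi' ℓ).norm.add (hi.norm.mul_const _)).mul_const _
  · filter_upwards [ae_all_iff.2 hB] with x hx
    refine (norm_sum_le _ _).trans (Finset.sum_le_sum fun ℓ _ => ?_)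
    rw [norm_smul]
    exact mul_le_mul (fderiv_cutoff_le n x _) (hx ℓ) (norm_nonneg _) (by positivity)
  · refine tendsto_const_nhds.congr' ((c_eq x).mono fun n hn => ?_)
    have cutoff_eq : (fun y => c n y * ρ y) =ᶠ[𝓝 x] ρ := by
      filter_upwards [hn] with y hy
      rw [hy, one_mul]
    simp only [cutoff_eq.fderiv_eq]

end DivergenceFree

section Currents

variable {d N : ℕ} {F : Type*} [NormedAddCommGroup F] [NormedSpace ℝ F]

theorem IsWeaklyDivergenceFree.comp_particle {h : Fin d → Position d → F}
    (hdiv : IsWeaklyDivergenceFree (fun ℓ => EuclideanSpace.single ℓ 1) h volume)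
    (hh : ∀ ℓ, MemLp (h ℓ) ⊤) (j : Fin N) :
    IsWeaklyDivergenceFree (fun ℓ => EuclideanSpace.single (j, ℓ) 1)
      (fun ℓ (X : Config d N) => h ℓ (particle j X)) volume := by
  intro ρ hρ hc
  have integrable : Integrable fun X =>
      ∑ ℓ, fderiv ℝ ρ X (EuclideanSpace.single (j, ℓ) 1) • h ℓ (particle j X) := by
    exact integrable_finsetSum _ fun ℓ _ => integrable_fderiv_smul hρ hc _
      (memLp_top_comp_quasiMeasurePreserving (hh ℓ) (quasiMeasurePreserving_particle j))
  have split := measurePreserving_assemble (d := d) j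
  have embedding := (assemble (d := d) j).measurableEmbedding
  rw [← split.integral_comp embedding]
  refine (integral_prod_symm _ ((split.integrable_comp_emb embedding).2 integrable)).trans
    (integral_eq_zero_of_ae (.of_forall fun y => ?_))
  have slice_eq : (fun x => assemble j (x, y)) = fun x => displace j x + assemble j (0, y) :=
    funext fun x => assemble_eq_displace_add j x y
  have slice_fderiv : ∀ x, HasFDerivAt (fun x => assemble j (x, y)) (displace (d := d) j) x :=
    fun x => slice_eq ▸ (displace j).hasFDerivAt.add_const _
  have slice_smooth : ContDiff ℝ ((⊤ : ℕ∞) : WithTop ℕ∞) fun x : Position d => assemble j (x, y) :=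
    slice_eq ▸ (displace j).contDiff.add contDiff_const
  have slice_embedding : Topology.IsClosedEmbedding fun x : Position d => assemble j (x, y) :=
    Function.LeftInverse.isClosedEmbedding (f := particle j)
      (fun x => particle_assemble j (x, y)) (continuous_particle j) slice_smooth.continuous
  refine .trans (integral_congr_ae (.of_forall fun x => Finset.sum_congr rfl fun ℓ _ => ?_))
    (hdiv _ (hρ.comp slice_smooth) (hc.comp_isClosedEmbedding slice_embedding))
  have chain := (hρ.differentiable (by simp) (assemble j (x, y))).hasFDerivAt.comp x
    (slice_fderiv x)
  rw [chain.fderiv, particle_assemble, ContinuousLinearMap.comp_apply, displace_single]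

theorem InH1.sum_integral_densityDeriv_smul_eq_zero [CompleteSpace F] {ψ : Wave d N}
    (hψ : InH1 ψ) (j : Fin N) {h : Fin d → Position d → F}
    (hdiv : IsWeaklyDivergenceFree (fun ℓ => EuclideanSpace.single ℓ 1) h volume)
    (hh : ∀ ℓ, MemLp (h ℓ) ⊤) :
    ∑ ℓ, ∫ X, densityDeriv ψ j ℓ X • h ℓ (particle j X) = 0 := by
  have memLp_top : ∀ ℓ, MemLp (fun X => h ℓ (particle j X)) ⊤ (volume : Measure (Config d N)) :=
    fun ℓ => memLp_top_comp_quasiMeasurePreserving (hh ℓ) (quasiMeasurePreserving_particle j)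
  have density := hψ.sum_integral_densityDeriv_smul j Finset.univ memLp_top
    (b := fun _ => 0) MemLp.zero fun φ => ?_
  · simpa only [smul_zero, integral_zero] using density
  · refine (integral_finsetSum _ fun ℓ _ =>
      (integrable_fderiv_norm_sq_schwartz φ _).smul_of_top_left (memLp_top ℓ)).symm.trans ?_
    simp only [smul_zero, integral_zero]
    exact (hdiv.comp_particle hh j).integral_eq_zero memLp_top (φ.smooth'.norm_sq ℝ)
      (integrable_norm_sq_schwartz φ) fun ℓ => integrable_fderiv_norm_sq_schwartz φ _

end Currents

section DispersionRelation

variable {𝔥 : Type*} [NormedAddCommGroup 𝔥] [InnerProductSpace ℂ 𝔥] [CompleteSpace 𝔥]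
  (ω : Dispersion 𝔥)

theorem Dispersion.eq_zero_of_mem_half_graph {x : 𝔥} (hx : (x, 0) ∈ ω.half.graph) : x = 0 :=
  ω.graph_injective ((ω.half_isSqrt.2.2 x 0).2 ⟨0, hx, zero_mem _⟩)

theorem Dispersion.negHalfApply_mem_half_graph {v : 𝔥} (hv : v ∈ ω.negHalf.domain) :
    (ω.negHalfApply v, v) ∈ ω.half.graph := by
  have half_injective : LinearMap.ker ω.half.toFun = ⊥ := by
    refine LinearMap.ker_eq_bot'.2 fun x hx => Subtype.ext (ω.eq_zero_of_mem_half_graph ?_)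
    exact hx ▸ ω.half.mem_graph x
  have mem_inverse : (v, ω.negHalfApply v) ∈ ω.half.inverse.graph := by
    rw [Dispersion.negHalfApply, dif_pos hv]
    exact ω.negHalf.mem_graph ⟨v, hv⟩
  simpa [LinearPMap.inverse_graph half_injective] using mem_inverse

theorem Dispersion.inner_negHalfApply {x y v : 𝔥} (hxy : (x, y) ∈ ω.half.graph)
    (hv : v ∈ ω.negHalf.domain) : ⟪y, ω.negHalfApply v⟫_ℂ = ⟪x, v⟫_ℂ :=
  Dispersion.symm_of_isSelfAdjoint ω.half_isSqrt.1 hxy (ω.negHalfApply_mem_half_graph hv)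

theorem Dispersion.eq_zero_of_forall_inner_half {w : 𝔥}
    (hw : ∀ x y, (x, y) ∈ ω.half.graph → ⟪y, w⟫_ℂ = 0) : w = 0 :=
  ω.eq_zero_of_mem_half_graph <| Dispersion.mem_graph_of_isSelfAdjoint ω.half_isSqrt.1
    fun x y hxy => by rw [inner_zero_left, inner_eq_zero_symm.1 (hw x y hxy)]

theorem IsWeaklyDivergenceFree.negHalfApply {ι E : Type*} [Fintype ι] [NormedAddCommGroup E]
    [NormedSpace ℝ E] [MeasurableSpace E] [OpensMeasurableSpace E] {μ : Measure E}
    [IsFiniteMeasureOnCompacts μ] {v : ι → E} {h : ι → E → 𝔥} (hdiv : IsWeaklyDivergenceFree v h μ)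
    (hh : ∀ ℓ, MemLp (h ℓ) ⊤ μ) (hdom : ∀ ℓ, ∀ᵐ x ∂μ, h ℓ x ∈ ω.negHalf.domain)
    (hneg : ∀ ℓ, MemLp (fun x => ω.negHalfApply (h ℓ x)) ⊤ μ) :
    IsWeaklyDivergenceFree v (fun ℓ x => ω.negHalfApply (h ℓ x)) μ := by
  intro ρ hρ hc
  refine ω.eq_zero_of_forall_inner_half fun x y hxy => ?_
  rw [← integral_inner (integrable_finsetSum _ fun ℓ _ => integrable_fderiv_smul hρ hc _ (hneg ℓ)),
    ← inner_zero_right x, ← hdiv ρ hρ hc,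
    ← integral_inner (integrable_finsetSum _ fun ℓ _ => integrable_fderiv_smul hρ hc _ (hh ℓ))]
  refine integral_congr_ae ?_
  filter_upwards [ae_all_iff.2 hdom] with X hX
  simp only [inner_sum, inner_smul_right_eq_smul, ω.inner_negHalfApply hxy (hX _)]

end DispersionRelation

/-! ### The Pauli–Fierz model -/

section GramOperator

variable {α H G : Type*} [MeasurableSpace α] {μ : Measure α} [NormedAddCommGroup H]
  [InnerProductSpace ℝ H] [NormedAddCommGroup G]

/-- The second moment `η ↦ ∫ ‖ψ‖² ⟨η, ζ⟩ ζ` of the random vector `ζ` under the density `‖ψ‖²`. -/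
noncomputable def gramOperator (ψ : Lp G 2 μ) (ζ : α → H) : H →L[ℝ] H :=
  ∫ x, (‖ψ x‖ ^ 2) • InnerProductSpace.rankOne ℝ (ζ x) (ζ x) ∂μ

theorem integrable_norm_sq_smul_rankOne (ψ : Lp G 2 μ) {ζ : α → H} (hζ : MemLp ζ ⊤ μ) :
    Integrable (fun x => (‖ψ x‖ ^ 2) • InnerProductSpace.rankOne ℝ (ζ x) (ζ x)) μ := by
  obtain ⟨C, hC, hbound⟩ := exists_ae_norm_le_of_memLp_top hζ
  have rankOne_continuous : Continuous fun y : H => InnerProductSpace.rankOne ℝ y y :=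
    (InnerProductSpace.rankOne ℝ).continuous.clm_apply continuous_id
  refine (integrable_norm_sq ψ).smul_of_top_left
    (memLp_top_of_bound (rankOne_continuous.comp_aestronglyMeasurable hζ.1) (C * C) ?_)
  filter_upwards [hbound] with x hx
  rw [InnerProductSpace.norm_rankOne]
  gcongr

theorem gramOperator_apply (ψ : Lp G 2 μ) {ζ : α → H} (hζ : MemLp ζ ⊤ μ) (η : H) :
    gramOperator ψ ζ η = ∫ x, (‖ψ x‖ ^ 2 * ⟪η, ζ x⟫_ℝ) • ζ x ∂μ := by
  rw [gramOperator, ContinuousLinearMap.integral_apply (integrable_norm_sq_smul_rankOne ψ hζ)]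
  simp only [smul_apply, InnerProductSpace.rankOne_apply, smul_smul, real_inner_comm]

theorem integrable_norm_sq_mul_inner_smul (ψ : Lp G 2 μ) {ζ : α → H} (hζ : MemLp ζ ⊤ μ) (η : H) :
    Integrable (fun x => (‖ψ x‖ ^ 2 * ⟪η, ζ x⟫_ℝ) • ζ x) μ :=
  ((integrable_norm_sq ψ).smul_of_top_left (hζ.const_inner (𝕜 := ℝ) η)).smul_of_top_left hζ

variable [CompleteSpace H]

theorem inner_gramOperator_apply (ψ : Lp G 2 μ) {ζ : α → H} (hζ : MemLp ζ ⊤ μ) (η δ : H) :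
    ⟪gramOperator ψ ζ η, δ⟫_ℝ = ∫ x, ‖ψ x‖ ^ 2 * (⟪η, ζ x⟫_ℝ * ⟪δ, ζ x⟫_ℝ) ∂μ := by
  rw [gramOperator_apply ψ hζ, real_inner_comm,
    ← integral_inner (integrable_norm_sq_mul_inner_smul ψ hζ η)]
  simp only [real_inner_smul_right, mul_assoc]

theorem isPositive_gramOperator (ψ : Lp G 2 μ) {ζ : α → H} (hζ : MemLp ζ ⊤ μ) :
    (gramOperator ψ ζ).IsPositive := by
  refine (ContinuousLinearMap.isPositive_iff _).2 ⟨fun η δ => ?_, fun η => ?_⟩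
  · rw [ContinuousLinearMap.coe_coe, real_inner_comm (_ : H) η, inner_gramOperator_apply ψ hζ,
      inner_gramOperator_apply ψ hζ]
    simp only [mul_comm]
  · rw [inner_gramOperator_apply ψ hζ]
    exact integral_nonneg fun x => mul_nonneg (sq_nonneg _) (mul_self_nonneg _)

variable [InnerProductSpace ℝ G]

theorem integral_norm_add_inner_smul_sq (p ψ : Lp G 2 μ) {ζ : α → H} (hζ : MemLp ζ ⊤ μ) (η : H) :
    ∫ x, ‖p x + ⟪η, ζ x⟫_ℝ • ψ x‖ ^ 2 ∂μ =
      ‖p‖ ^ 2 + 2 * ⟪η, ∫ x, ⟪ψ x, p x⟫_ℝ • ζ x ∂μ⟫_ℝ + ⟪gramOperator ψ ζ η, η⟫_ℝ := by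
  have hinner : MemLp (fun x => ⟪η, ζ x⟫_ℝ) ⊤ μ := hζ.const_inner (𝕜 := ℝ) η
  have current_integrable : Integrable (fun x => ⟪ψ x, p x⟫_ℝ * ⟪η, ζ x⟫_ℝ) μ :=
    (L2.integrable_inner (𝕜 := ℝ) ψ p).smul_of_top_left hinner
  have linear_integrable :
      Integrable (fun x => ‖p x‖ ^ 2 + 2 * (⟪ψ x, p x⟫_ℝ * ⟪η, ζ x⟫_ℝ)) μ :=
    (integrable_norm_sq p).add (current_integrable.const_mul 2)
  have gram_integrable : Integrable (fun x => ‖ψ x‖ ^ 2 * (⟪η, ζ x⟫_ℝ * ⟪η, ζ x⟫_ℝ)) μ :=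
    (integrable_norm_sq ψ).smul_of_top_left (hinner.mul hinner)
  have pointwise : ∀ x, ‖p x + ⟪η, ζ x⟫_ℝ • ψ x‖ ^ 2 = ‖p x‖ ^ 2 +
      2 * (⟪ψ x, p x⟫_ℝ * ⟪η, ζ x⟫_ℝ) + ‖ψ x‖ ^ 2 * (⟪η, ζ x⟫_ℝ * ⟪η, ζ x⟫_ℝ) := fun x => by
    rw [norm_add_sq_real, real_inner_smul_right, norm_smul, mul_pow, Real.norm_eq_abs, sq_abs,
      real_inner_comm (p x)]
    ring
  have inner_current : ⟪η, ∫ x, ⟪ψ x, p x⟫_ℝ • ζ x ∂μ⟫_ℝ = ∫ x, ⟪ψ x, p x⟫_ℝ * ⟪η, ζ x⟫_ℝ ∂μ := by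
    have hint : Integrable (fun x => ⟪ψ x, p x⟫_ℝ • ζ x) μ :=
      (L2.integrable_inner (𝕜 := ℝ) ψ p).smul_of_top_left hζ
    rw [← integral_inner hint]
    simp only [real_inner_smul_right]
  rw [inner_gramOperator_apply ψ hζ, inner_current, ← integral_norm_sq, ← integral_const_mul,
    ← integral_add (integrable_norm_sq p) (current_integrable.const_mul 2),
    ← integral_add linear_integrable gram_integrable]
  simp only [pointwise]

end GramOperator

section PauliFierz

variable {N : ℕ} {𝔥 : Type*} [NormedAddCommGroup 𝔥] [InnerProductSpace ℂ 𝔥]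

theorem conj_mul_momentum_eq {d : ℕ} (ψ : Wave d N) (j : Fin N) (ℓ : Fin d) (X : Config d N) :
    starRingEnd ℂ (ψ X) * momentum ψ j ℓ X =
      (⟪ψ X, momentum ψ j ℓ X⟫_ℝ : ℂ) - (Complex.I / 2) * densityDeriv ψ j ℓ X := by
  apply Complex.ext <;> simp [densityDeriv, Complex.inner] <;> ring

theorem InH1.sum_integral_conj_mul_momentum_smul [CompleteSpace 𝔥] {d : ℕ} {ψ : Wave d N}
    (hψ : InH1 ψ) (j : Fin N) {h : Fin d → Position d → 𝔥}
    (hdiv : IsWeaklyDivergenceFree (fun ℓ => EuclideanSpace.single ℓ 1) h volume)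
    (hh : ∀ ℓ, MemLp (h ℓ) ⊤) :
    ∑ ℓ, ∫ X, (starRingEnd ℂ (ψ X) * momentum ψ j ℓ X) • h ℓ (particle j X) =
      ∑ ℓ, ∫ X, ⟪ψ X, momentum ψ j ℓ X⟫_ℝ • h ℓ (particle j X) := by
  have memLp_top : ∀ ℓ, MemLp (fun X => h ℓ (particle j X)) ⊤ (volume : Measure (Config d N)) :=
    fun ℓ => memLp_top_comp_quasiMeasurePreserving (hh ℓ) (quasiMeasurePreserving_particle j)
  have split : ∀ ℓ, ∫ X, (starRingEnd ℂ (ψ X) * momentum ψ j ℓ X) • h ℓ (particle j X) =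
      (∫ X, ⟪ψ X, momentum ψ j ℓ X⟫_ℝ • h ℓ (particle j X)) -
        (Complex.I / 2) • ∫ X, densityDeriv ψ j ℓ X • h ℓ (particle j X) := fun ℓ => by
    rw [← integral_smul, ← integral_sub]
    · simp only [conj_mul_momentum_eq, sub_smul, mul_smul, Complex.coe_smul]
    · exact (L2.integrable_inner (𝕜 := ℝ) ψ _).smul_of_top_left (memLp_top ℓ)
    · exact ((integrable_densityDeriv ψ j ℓ).smul_of_top_left (memLp_top ℓ)).smul _
  rw [Finset.sum_congr rfl fun ℓ _ => split ℓ, Finset.sum_sub_distrib, ← Finset.smul_sum,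
    hψ.sum_integral_densityDeriv_smul_eq_zero j hdiv hh, smul_zero, sub_zero]

attribute [local instance] InnerProductSpace.complexToReal

variable [CompleteSpace 𝔥] {ω : Dispersion 𝔥} {m : Fin N → ℝ} {e : ℝ}
  {lam : Fin N → Fin 3 → Position 3 → 𝔥} {W : Config 3 N → ℝ} {ψ : Wave 3 N}

/-- The coupling function `ξ_j` of `pauliFierzFieldEq`, as a function of the configuration. -/
noncomputable def pauliFierzCoupling (ω : Dispersion 𝔥) (lam : Fin N → Fin 3 → Position 3 → 𝔥)
    (j : Fin N) (ℓ : Fin 3) (X : Config 3 N) : 𝔥 :=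
  ω.negHalfApply (lam j ℓ (particle j X))

/-- The part `e ∑_j m_j⁻¹ Re ⟨ψ, ξ_j · (-i∇_j) ψ⟩` of `pauliFierzFieldEq`, which is independent of
the field. -/
noncomputable def pauliFierzCurrent (ω : Dispersion 𝔥) (m : Fin N → ℝ) (e : ℝ)
    (lam : Fin N → Fin 3 → Position 3 → 𝔥) (ψ : Wave 3 N) : 𝔥 :=
  ∑ j, (e / m j) • ∑ ℓ, ∫ X, ⟪ψ X, momentum ψ j ℓ X⟫_ℝ • pauliFierzCoupling ω lam j ℓ X

/-- The part of `pauliFierzFieldEq` which is linear in the field. -/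
noncomputable def pauliFierzOperator (ω : Dispersion 𝔥) (m : Fin N → ℝ) (e : ℝ)
    (lam : Fin N → Fin 3 → Position 3 → 𝔥) (ψ : Wave 3 N) : 𝔥 →L[ℝ] 𝔥 :=
  ∑ j, (2 * e ^ 2 / m j) • ∑ ℓ, gramOperator ψ (pauliFierzCoupling ω lam j ℓ)

theorem memLp_top_pauliFierzCoupling
    (hlam : ∀ j ℓ, MemLp (fun x => ω.negHalfApply (lam j ℓ x)) ⊤) (j : Fin N) (ℓ : Fin 3) :
    MemLp (pauliFierzCoupling ω lam j ℓ) ⊤ :=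
  memLp_top_comp_quasiMeasurePreserving (hlam j ℓ) (quasiMeasurePreserving_particle j)

theorem isPositive_pauliFierzOperator (hm : ∀ j, 0 < m j)
    (hlam : ∀ j ℓ, MemLp (fun x => ω.negHalfApply (lam j ℓ x)) ⊤) (ψ : Wave 3 N) :
    (pauliFierzOperator ω m e lam ψ).IsPositive :=
  ContinuousLinearMap.isPositive_sum _ fun j _ => .smul_of_nonneg
    (ContinuousLinearMap.isPositive_sum _ fun ℓ _ =>
      isPositive_gramOperator ψ (memLp_top_pauliFierzCoupling hlam j ℓ))
    (div_nonneg (by positivity) (hm j).le)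

theorem pauliFierzEnergy_of_mem (hlam : ∀ j ℓ, MemLp (fun x => ω.negHalfApply (lam j ℓ x)) ⊤)
    (hψ : ψ ∈ formDomain W) (z : ω.FieldSpace) :
    pauliFierzEnergy ω m e lam W ψ z =
      (((∑ j, 1 / (2 * m j) * ∑ ℓ, ‖momentum ψ j ℓ‖ ^ 2) + ∫ X, W X * ‖ψ X‖ ^ 2)
        + 2 * ⟪ω.halfIso z, pauliFierzCurrent ω m e lam ψ⟫_ℝ
        + ⟪pauliFierzOperator ω m e lam ψ (ω.halfIso z), ω.halfIso z⟫_ℝ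
        + ‖ω.halfIso z‖ ^ 2 : ℝ) := by
  set η := ω.halfIso z
  have kinetic : ∀ j ℓ, ∫ X, ‖momentum ψ j ℓ X
      + (e * vectorPotential ω lam z j ℓ (particle j X) : ℝ) * ψ X‖ ^ 2 =
      ‖momentum ψ j ℓ‖ ^ 2
        + 4 * e * ⟪η, ∫ X, ⟪ψ X, momentum ψ j ℓ X⟫_ℝ • pauliFierzCoupling ω lam j ℓ X⟫_ℝ
        + 4 * e ^ 2 * ⟪gramOperator ψ (pauliFierzCoupling ω lam j ℓ) η, η⟫_ℝ := fun j ℓ => by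
    have potential_eq : ∀ X, e * vectorPotential ω lam z j ℓ (particle j X) =
        ⟪(2 * e) • η, pauliFierzCoupling ω lam j ℓ X⟫_ℝ := fun X => by
      rw [real_inner_smul_left, real_inner_eq_re_inner ℂ, vectorPotential, Dispersion.pairing,
        pauliFierzCoupling, RCLike.re_to_complex]
      ring
    simp only [potential_eq, ← Complex.real_smul]
    rw [integral_norm_add_inner_smul_sq _ _ (memLp_top_pauliFierzCoupling hlam j ℓ)]
    simp only [map_smul, real_inner_smul_left, real_inner_smul_right]
    ring
  have current_coeff : ∀ j a, 1 / (2 * m j) * (4 * e * a) = 2 * (e / m j * a) := fun j a => by ring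
  have operator_coeff : ∀ j a, 1 / (2 * m j) * (4 * e ^ 2 * a) = 2 * e ^ 2 / m j * a :=
    fun j a => by ring
  have norm_eq : ‖z‖ = ‖η‖ := (ω.halfIso.norm_map z).symm
  simp only [pauliFierzEnergy, hψ, if_true, kinetic, pauliFierzCurrent, pauliFierzOperator,
    sum_apply, smul_apply, inner_sum, sum_inner, real_inner_smul_left, real_inner_smul_right,
    Finset.sum_add_distrib, Finset.mul_sum, mul_add, current_coeff, operator_coeff, norm_eq]
  ring_nf

theorem pauliFierzFieldEq_iff (hdom : ∀ j ℓ, ∀ᵐ x, lam j ℓ x ∈ ω.negHalf.domain)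
    (hlam : ∀ j ℓ, MemLp (lam j ℓ) ⊤)
    (hneg : ∀ j ℓ, MemLp (fun x => ω.negHalfApply (lam j ℓ x)) ⊤)
    (hdiv : ∀ j, IsDivergenceFree (lam j)) (hψ : InH1 ψ) (η : 𝔥) :
    pauliFierzFieldEq ω m e lam ψ η ↔
      η + pauliFierzOperator ω m e lam ψ η + pauliFierzCurrent ω m e lam ψ = 0 := by
  have field_term : ∀ j ℓ, ∫ X, (e * (starRingEnd ℂ (ψ X) * momentum ψ j ℓ X)
      + 2 * e ^ 2 * (⟪η, ω.negHalfApply (lam j ℓ (particle j X))⟫_ℂ).re * ‖ψ X‖ ^ 2 : ℂ)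
      • ω.negHalfApply (lam j ℓ (particle j X)) =
      e • (∫ X, (starRingEnd ℂ (ψ X) * momentum ψ j ℓ X)
        • ω.negHalfApply (lam j ℓ (particle j X)))
      + (2 * e ^ 2) • gramOperator ψ (pauliFierzCoupling ω lam j ℓ) η := fun j ℓ => by
    have coupling := memLp_top_pauliFierzCoupling hneg j ℓ
    rw [gramOperator_apply ψ coupling, ← integral_smul, ← integral_smul, ← integral_add]
    · refine integral_congr_ae (.of_forall fun X => ?_)
      simp only [pauliFierzCoupling, smul_smul, ← Complex.coe_smul, ← add_smul]
      congr 1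
      push_cast [real_inner_eq_re_inner ℂ, RCLike.re_to_complex]
      ring
    · have product_integrable := L2.integrable_inner (𝕜 := ℂ) ψ (momentum ψ j ℓ)
      simp only [RCLike.inner_apply'] at product_integrable
      exact (product_integrable.smul_of_top_left coupling).smul e
    · exact (integrable_norm_sq_mul_inner_smul ψ coupling η).smul (2 * e ^ 2)
  have current_term := fun j => hψ.sum_integral_conj_mul_momentum_smul j
    (IsWeaklyDivergenceFree.negHalfApply ω (hdiv j) (hlam j) (hdom j) (hneg j)) (hneg j)
  have regroup : ∀ j (a b : 𝔥), (1 / m j) • (e • a + (2 * e ^ 2) • b) =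
      (2 * e ^ 2 / m j) • b + (e / m j) • a := fun j a b => by module
  simp only [pauliFierzFieldEq, field_term, Finset.sum_add_distrib, ← Finset.smul_sum,
    current_term, regroup]
  simp only [pauliFierzOperator, pauliFierzCurrent, sum_apply, smul_apply, add_assoc,
    pauliFierzCoupling]

theorem pauliFierz_variationalEquivalence (hW : ∀ᵐ X, 0 ≤ W X) (hm : ∀ j, 0 < m j)
    (hdom : ∀ j ℓ, ∀ᵐ x, lam j ℓ x ∈ ω.negHalf.domain) (hlam : ∀ j ℓ, MemLp (lam j ℓ) ⊤)
    (hneg : ∀ j ℓ, MemLp (fun x => ω.negHalfApply (lam j ℓ x)) ⊤)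
    (hdiv : ∀ j, IsDivergenceFree (lam j)) :
    VariationalEquivalence (pauliFierzEnergy ω m e lam W) ω.halfIso
      (pauliFierzFieldEq ω m e lam) := by
  refine variationalEquivalence_of_quadratic (D := formDomain W) (C := 0) _ _ _
    (fun ψ hψ z => by simp [pauliFierzEnergy, hψ])
    (fun ψ hψ z => pauliFierzEnergy_of_mem hneg hψ z)
    (fun ψ _ => isPositive_pauliFierzOperator hm hneg ψ) (fun ψ z _ => ?_)
    fun ψ hψ η => pauliFierzFieldEq_iff hdom hlam hneg hdiv hψ.1 η
  rw [pauliFierzEnergy]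
  split_ifs with hψ
  · have potential_nonneg : 0 ≤ ∫ X, W X * ‖ψ X‖ ^ 2 :=
      integral_nonneg_of_ae (hW.mono fun X hX => mul_nonneg hX (sq_nonneg _))
    have inv_mass_nonneg : ∀ j, 0 ≤ 1 / (2 * m j) := fun j => by have := hm j; positivity
    exact EReal.coe_le_coe_iff.2 (add_nonneg (add_nonneg (Finset.sum_nonneg fun j _ =>
      mul_nonneg (inv_mass_nonneg j) (by positivity)) potential_nonneg) (sq_nonneg _))
  · exact le_top

end PauliFierz

/-! ### The polaron potential -/

section PlaneWaves

variable {d N : ℕ}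

/-- The plane wave `e^{i k · x_j}` in the position of the `j`-th particle. -/
noncomputable def planeWave (j : Fin N) (k : Position d) (X : Config d N) : ℂ :=
  Complex.exp (Complex.I * (⟪k, particle j X⟫_ℝ : ℝ))

theorem norm_planeWave (j : Fin N) (k : Position d) (X : Config d N) : ‖planeWave j k X‖ = 1 :=
  Complex.norm_exp_I_mul_ofReal _

theorem continuous_planeWave_uncurry (j : Fin N) :
    Continuous fun p : Config d N × Position d => planeWave j p.2 p.1 := by
  have := continuous_particle (d := d) j
  unfold planeWave
  fun_prop

theorem memLp_top_planeWave (j : Fin N) (k : Position d) : MemLp (planeWave j k) ⊤ :=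
  memLp_top_of_bound
    ((continuous_planeWave_uncurry j).comp (Continuous.prodMk_left k)).aestronglyMeasurable 1
    (.of_forall fun X => (norm_planeWave j k X).le)

theorem hasFDerivAt_planeWave (j : Fin N) (k : Position d) (X : Config d N) :
    HasFDerivAt (planeWave j k) ((planeWave j k X * Complex.I) •
      Complex.ofRealCLM.comp (∑ ℓ, k ℓ • EuclideanSpace.proj (j, ℓ))) X := by
  have phase : ∀ X : Config d N,
      ⟪k, particle j X⟫_ℝ = (∑ ℓ, k ℓ • EuclideanSpace.proj (𝕜 := ℝ) (j, ℓ)) X := fun X => by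
    simp [PiLp.inner_apply, particle, mul_comm]
  unfold planeWave
  simp only [phase, mul_smul]
  exact ((Complex.ofRealCLM.comp _).hasFDerivAt.const_mul Complex.I).cexp

theorem fderiv_planeWave_single (j : Fin N) (k : Position d) (X : Config d N) (ℓ : Fin d) :
    fderiv ℝ (planeWave j k) X (EuclideanSpace.single (j, ℓ) 1) =
      Complex.I * k ℓ * planeWave j k X := by
  rw [(hasFDerivAt_planeWave j k X).fderiv]
  simp [PiLp.single_apply]
  ring

end PlaneWaves

section DensityFourier

variable {d N : ℕ} {ψ : Wave d N}

/-- The Fourier integral `∫ e^{i k · x_j} |ψ|²` of the density in the position of the `j`-th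
particle. -/
noncomputable def densityFourier (ψ : Wave d N) (j : Fin N) (k : Position d) : ℂ :=
  ∫ X, (‖ψ X‖ ^ 2) • planeWave j k X

theorem aestronglyMeasurable_densityFourier (ψ : Wave d N) (j : Fin N) :
    AEStronglyMeasurable (densityFourier ψ j) := by
  have integrand : AEStronglyMeasurable
      (fun p : Position d × Config d N => (‖ψ p.2‖ ^ 2) • planeWave j p.1 p.2)
      ((volume : Measure (Position d)).prod volume) :=
    (integrable_norm_sq ψ).aestronglyMeasurable.comp_snd.smul
      ((continuous_planeWave_uncurry j).comp continuous_swap).aestronglyMeasurable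
  exact integrand.integral_prod_right'

theorem norm_densityFourier_le (ψ : Wave d N) (j : Fin N) (k : Position d) :
    ‖densityFourier ψ j k‖ ≤ ‖ψ‖ ^ 2 := by
  simpa only [densityFourier, one_mul] using
    norm_integral_norm_sq_smul_le (.of_forall fun X => (norm_planeWave j k X).le) ψ

theorem InH1.integral_densityDeriv_smul_planeWave (hψ : InH1 ψ) (j : Fin N) (k : Position d)
    (ℓ : Fin d) :
    ∫ X, densityDeriv ψ j ℓ X • planeWave j k X =
      -(Complex.I * k ℓ) * densityFourier ψ j k := by
  have hwave := memLp_top_planeWave j k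
  have parts := hψ.sum_integral_densityDeriv_smul j {ℓ} (fun _ => hwave)
    (hwave.const_mul (-(Complex.I * k ℓ))) fun φ => ?_
  · simpa only [densityFourier, Finset.sum_singleton, ← mul_smul_comm, integral_const_mul]
      using parts
  · have density_integrable := integrable_norm_sq_schwartz φ (μ := volume)
    have parts_schwartz := integral_bilinear_fderiv_right_eq_neg_left_of_integrable
      (μ := volume) (B := ContinuousLinearMap.lsmul ℝ ℝ) (f := fun Y => ‖φ Y‖ ^ 2)
      (g := planeWave j k) (v := EuclideanSpace.single (j, ℓ) 1)
      ((integrable_fderiv_norm_sq_schwartz φ _).smul_of_top_left hwave) ?_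
      (density_integrable.smul_of_top_left hwave)
      (fun X _ => (φ.hasFDerivAt X).norm_sq.differentiableAt)
      (fun X _ => (hasFDerivAt_planeWave j k X).differentiableAt)
    · simpa only [ContinuousLinearMap.lsmul_apply, Finset.sum_singleton, fderiv_planeWave_single,
        neg_mul, smul_neg, integral_neg] using (neg_eq_iff_eq_neg.2 parts_schwartz).symm
    · simp only [fderiv_planeWave_single]
      exact density_integrable.smul_of_top_left (hwave.const_mul (Complex.I * k ℓ))

theorem integral_norm_inner_le {α G : Type*} [MeasurableSpace α] {μ : Measure α}
    [NormedAddCommGroup G] [InnerProductSpace ℝ G] (f g : Lp G 2 μ) :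
    ∫ x, ‖⟪f x, g x⟫_ℝ‖ ∂μ ≤ ‖f‖ * ‖g‖ := by
  have hnorm := (innerSL ℝ : G →L[ℝ] G →L[ℝ] ℝ).norm_holder_apply_apply_le (r := 1) f g
  rw [L1.norm_eq_integral_norm] at hnorm
  calc ∫ x, ‖⟪f x, g x⟫_ℝ‖ ∂μ ≤ ‖(innerSL ℝ : G →L[ℝ] G →L[ℝ] ℝ)‖ * ‖f‖ * ‖g‖ := by
        refine (integral_congr_ae ?_).trans_le hnorm
        filter_upwards [(innerSL ℝ : G →L[ℝ] G →L[ℝ] ℝ).coeFn_holder f g (r := 1)] with x hx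
        rw [hx, innerSL_apply_apply]
    _ ≤ ‖f‖ * ‖g‖ := by
        gcongr
        exact mul_le_of_le_one_left (norm_nonneg _) (norm_innerSL_le ℝ)

theorem integral_norm_densityDeriv_le (ψ : Wave d N) (j : Fin N) (ℓ : Fin d) :
    ∫ X, ‖densityDeriv ψ j ℓ X‖ ≤ 2 * ‖ψ‖ * ‖momentum ψ j ℓ‖ := by
  calc ∫ X, ‖densityDeriv ψ j ℓ X‖ = 2 * ∫ X, ‖⟪ψ X, (Complex.I • momentum ψ j ℓ) X⟫_ℝ‖ := by
        rw [← integral_const_mul]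
        refine integral_congr_ae ?_
        filter_upwards [densityDeriv_ae_eq ψ j ℓ] with X hX
        rw [hX, norm_mul, Real.norm_two]
    _ ≤ 2 * (‖ψ‖ * ‖Complex.I • momentum ψ j ℓ‖) := by
        gcongr
        exact integral_norm_inner_le _ _
    _ = 2 * ‖ψ‖ * ‖momentum ψ j ℓ‖ := by rw [norm_smul, Complex.norm_I, one_mul, mul_assoc]

theorem InH1.norm_coord_mul_densityFourier_le (hψ : InH1 ψ) (j : Fin N) (k : Position d)
    (ℓ : Fin d) : ‖k ℓ‖ * ‖densityFourier ψ j k‖ ≤ 2 * ‖ψ‖ * ‖momentum ψ j ℓ‖ := by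
  calc ‖k ℓ‖ * ‖densityFourier ψ j k‖ = ‖∫ X, densityDeriv ψ j ℓ X • planeWave j k X‖ := by
        rw [hψ.integral_densityDeriv_smul_planeWave]
        simp
    _ ≤ ∫ X, ‖densityDeriv ψ j ℓ X‖ := by
        refine (norm_integral_le_integral_norm _).trans_eq ?_
        simp only [norm_smul, norm_planeWave, mul_one]
    _ ≤ 2 * ‖ψ‖ * ‖momentum ψ j ℓ‖ := integral_norm_densityDeriv_le ψ j ℓ

theorem InH1.sq_norm_mul_norm_densityFourier_le (hψ : InH1 ψ) (j : Fin N) (k : Position d) :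
    (‖k‖ * ‖densityFourier ψ j k‖) ^ 2 ≤ 4 * ‖ψ‖ ^ 2 * ∑ ℓ, ‖momentum ψ j ℓ‖ ^ 2 := by
  calc (‖k‖ * ‖densityFourier ψ j k‖) ^ 2 = ∑ ℓ, (‖k ℓ‖ * ‖densityFourier ψ j k‖) ^ 2 := by
        simp only [mul_pow, EuclideanSpace.norm_sq_eq, Finset.sum_mul]
    _ ≤ ∑ ℓ, (2 * ‖ψ‖ * ‖momentum ψ j ℓ‖) ^ 2 := by
        refine Finset.sum_le_sum fun ℓ _ => pow_le_pow_left₀ (by positivity) ?_ 2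
        exact hψ.norm_coord_mul_densityFourier_le j k ℓ
    _ = 4 * ‖ψ‖ ^ 2 * ∑ ℓ, ‖momentum ψ j ℓ‖ ^ 2 := by
        rw [Finset.mul_sum]
        ring_nf

end DensityFourier

section BoundedKernel

variable {α β : Type*} [MeasurableSpace α] [MeasurableSpace β] {μ : Measure α} {ν : Measure β}
  {w : α → ℝ} {F : β → ℂ} {κ : α × β → ℂ} {C : ℝ}

theorem integrable_smul_mul_kernel (hw : Integrable w μ) (hF : Integrable F ν)
    (hκ : AEStronglyMeasurable κ (μ.prod ν)) (hC : ∀ p, ‖κ p‖ ≤ C) :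
    Integrable (fun p => w p.1 • (F p.2 * κ p)) (μ.prod ν) :=
  ((hw.smul_prod hF).bdd_mul hκ (.of_forall hC)).congr
    (.of_forall fun p => by simp only [mul_smul_comm, mul_comm])

theorem integrable_mul_integral_smul_kernel [SFinite μ] [SFinite ν] (hw : Integrable w μ)
    (hF : Integrable F ν) (hκ : AEStronglyMeasurable κ (μ.prod ν)) (hC : ∀ p, ‖κ p‖ ≤ C) :
    Integrable (fun y => F y * ∫ x, w x • κ (x, y) ∂μ) ν := by
  simpa only [← mul_smul_comm, integral_const_mul] using
    (integrable_smul_mul_kernel hw hF hκ hC).integral_prod_right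

theorem integral_smul_integral_mul_kernel [SFinite μ] [SFinite ν] (hw : Integrable w μ)
    (hF : Integrable F ν) (hκ : AEStronglyMeasurable κ (μ.prod ν)) (hC : ∀ p, ‖κ p‖ ≤ C) :
    ∫ x, w x • ∫ y, F y * κ (x, y) ∂ν ∂μ = ∫ y, F y * ∫ x, w x • κ (x, y) ∂μ ∂ν := by
  simp only [← integral_smul, ← integral_const_mul, mul_smul_comm]
  exact integral_integral_swap (integrable_smul_mul_kernel hw hF hκ hC)

end BoundedKernel

section InverseFourier

variable {d N : ℕ} {w : Config d N → ℝ} {f : Position d → ℝ}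

theorem integrable_mul_integral_smul_planeWave (hw : Integrable w) (hf : MemLp f 2)
    (z : PhononSpace d) (j : Fin N) :
    Integrable fun k => f k * z k * ∫ X, w X • planeWave j k X :=
  integrable_mul_integral_smul_kernel (F := fun k => f k * z k)
    (κ := fun p : Config d N × Position d => planeWave j p.2 p.1) (C := 1) hw
    ((hf.ofReal (K := ℂ)).integrable_mul (Lp.memLp z))
    (continuous_planeWave_uncurry j).aestronglyMeasurable fun p => (norm_planeWave j p.2 p.1).le

theorem integral_smul_invFourierInt (hw : Integrable w) (hf : MemLp f 2) (z : PhononSpace d)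
    (j : Fin N) :
    ∫ X, w X • invFourierInt f z (particle j X) =
      ∫ k, f k * z k * ∫ X, w X • planeWave j k X := by
  have swap := integral_smul_integral_mul_kernel (F := fun k => f k * z k)
    (κ := fun p : Config d N × Position d => planeWave j p.2 p.1) (C := 1) hw
    ((hf.ofReal (K := ℂ)).integrable_mul (Lp.memLp z))
    (continuous_planeWave_uncurry j).aestronglyMeasurable fun p => (norm_planeWave j p.2 p.1).le
  rw [← swap]
  simp only [invFourierInt, planeWave, mul_assoc, mul_comm, mul_left_comm]

end InverseFourier

section Radial

open Filter Topology

theorem integrable_indicator_rpow_norm {E : Type*} [NormedAddCommGroup E] [NormedSpace ℝ E]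
    [FiniteDimensional ℝ E] [Nontrivial E] [MeasurableSpace E] [BorelSpace E] (μ : Measure E)
    [μ.IsAddHaarMeasure] {S : Set ℝ} (hS : MeasurableSet S) {s : ℝ}
    (h : IntegrableOn (fun r => r ^ (s + (Module.finrank ℝ E - 1 : ℕ))) (S ∩ Set.Ioi 0)) :
    Integrable (fun x : E => S.indicator (· ^ s) ‖x‖) μ := by
  have radial : IntegrableOn (S.indicator fun r => r ^ (s + (Module.finrank ℝ E - 1 : ℕ)))
      (Set.Ioi 0) :=
    (integrable_indicator_iff hS).2 (by rwa [IntegrableOn, Measure.restrict_restrict hS])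
  rw [integrable_fun_norm_addHaar μ (f := S.indicator (· ^ s))]
  refine radial.congr_fun (fun r hr => ?_) measurableSet_Ioi
  by_cases hrS : r ∈ S
  · simp [hrS, Real.rpow_add_natCast (Set.mem_Ioi.1 hr).ne', mul_comm]
  · simp [hrS]

variable {d : ℕ} {ϱ : ℝ}

/-- The modulus `1_{|k| > ϱ} |k|^{-(d+1)/2}` of the vector `highFactor d ϱ · k`. -/
noncomputable def highModulus (d : ℕ) (ϱ : ℝ) (k : Position d) : ℝ :=
  if ϱ < ‖k‖ then ‖k‖ ^ (-((d : ℝ) + 1) / 2) else 0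

theorem highModulus_nonneg (ϱ : ℝ) (k : Position d) : 0 ≤ highModulus d ϱ k := by
  unfold highModulus
  positivity

theorem highModulus_anti {R : ℝ} (h : ϱ ≤ R) (k : Position d) :
    highModulus d R k ≤ highModulus d ϱ k := by
  by_cases hk : R < ‖k‖
  · simp only [highModulus, hk, h.trans_lt hk, if_true, le_refl]
  · simpa only [highModulus, hk, if_false] using highModulus_nonneg ϱ k

theorem highFactor_eq_highModulus_mul (ϱ : ℝ) (ℓ : Fin d) (k : Position d) :
    highFactor d ϱ ℓ k = highModulus d ϱ k * (k ℓ / ‖k‖) := by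
  simp only [highFactor, highModulus, ite_mul, zero_mul]

theorem sum_highFactor_mul_coord (ϱ : ℝ) (k : Position d) :
    ∑ ℓ, highFactor d ϱ ℓ k * k ℓ = ‖k‖ * highModulus d ϱ k := by
  calc ∑ ℓ, highFactor d ϱ ℓ k * k ℓ = highModulus d ϱ k * (‖k‖ ^ 2 / ‖k‖) := by
        rw [EuclideanSpace.real_norm_sq_eq, Finset.sum_div, Finset.mul_sum]
        exact Finset.sum_congr rfl fun ℓ _ => by rw [highFactor_eq_highModulus_mul]; ring
    _ = ‖k‖ * highModulus d ϱ k := by rw [sq, mul_self_div_self, mul_comm]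

theorem norm_mul_highModulus (hϱ : 0 ≤ ϱ) (k : Position d) : ‖k‖ * highModulus d ϱ k =
    if ϱ < ‖k‖ then ‖k‖ ^ (-((d : ℝ) - 1) / 2) else 0 := by
  split_ifs with hk
  · rw [highModulus, if_pos hk, mul_comm, ← Real.rpow_add_one (hϱ.trans_lt hk).ne']
    ring_nf
  · rw [highModulus, if_neg hk, mul_zero]

theorem lowFactor_add_norm_mul_highModulus (hϱ : 0 ≤ ϱ) (k : Position d) :
    lowFactor d ϱ k + ‖k‖ * highModulus d ϱ k = ‖k‖ ^ (-((d : ℝ) - 1) / 2) := by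
  rw [norm_mul_highModulus hϱ, lowFactor]
  split_ifs <;> linarith

theorem sq_lowFactor_add_sq_norm_mul_highModulus (hϱ : 0 ≤ ϱ) (k : Position d) :
    lowFactor d ϱ k ^ 2 + (‖k‖ * highModulus d ϱ k) ^ 2 =
      (‖k‖ ^ (-((d : ℝ) - 1) / 2)) ^ 2 := by
  rw [norm_mul_highModulus hϱ, lowFactor]
  split_ifs <;> linarith

@[fun_prop]
theorem measurable_lowFactor (d : ℕ) (ϱ : ℝ) : Measurable (lowFactor d ϱ) :=
  .ite (measurableSet_le (by fun_prop) (by fun_prop)) (by fun_prop) (by fun_prop)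

@[fun_prop]
theorem measurable_highModulus (d : ℕ) (ϱ : ℝ) : Measurable (highModulus d ϱ) :=
  .ite (measurableSet_lt (by fun_prop) (by fun_prop)) (by fun_prop) (by fun_prop)

theorem sq_lowFactor_eq_indicator (ϱ : ℝ) (k : Position d) :
    lowFactor d ϱ k ^ 2 = (Set.Iic ϱ).indicator (· ^ (-((d : ℝ) - 1))) ‖k‖ := by
  by_cases hk : ‖k‖ ≤ ϱ
  · simp only [lowFactor, Set.indicator, Set.mem_Iic, hk, if_true]
    rw [← Real.rpow_natCast, ← Real.rpow_mul (norm_nonneg k)]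
    norm_num
  · simp [lowFactor, hk]

theorem sq_highModulus_eq_indicator (ϱ : ℝ) (k : Position d) :
    highModulus d ϱ k ^ 2 = (Set.Ioi ϱ).indicator (· ^ (-((d : ℝ) + 1))) ‖k‖ := by
  by_cases hk : ϱ < ‖k‖
  · simp only [highModulus, Set.indicator, Set.mem_Ioi, hk, if_true]
    rw [← Real.rpow_natCast, ← Real.rpow_mul (norm_nonneg k)]
    norm_num
  · simp [highModulus, hk]

variable [NeZero d]

theorem memLp_lowFactor (ϱ : ℝ) : MemLp (lowFactor d ϱ) 2 := by
  rw [memLp_two_iff_integrable_sq (by fun_prop)]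
  simp only [sq_lowFactor_eq_indicator]
  refine integrable_indicator_rpow_norm volume measurableSet_Iic ?_
  rw [finrank_euclideanSpace_fin, Nat.cast_pred (NeZero.pos d), neg_add_cancel]
  simp only [Real.rpow_zero]
  rw [Set.inter_comm, Set.Ioi_inter_Iic]
  exact integrableOn_const measure_Ioc_lt_top.ne

theorem memLp_highModulus (hϱ : 0 < ϱ) : MemLp (highModulus d ϱ) 2 := by
  rw [memLp_two_iff_integrable_sq (by fun_prop)]
  simp only [sq_highModulus_eq_indicator]
  refine integrable_indicator_rpow_norm volume measurableSet_Ioi ?_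
  rw [finrank_euclideanSpace_fin, Nat.cast_pred (NeZero.pos d), Set.Ioi_inter_Ioi,
    max_eq_left hϱ.le]
  exact integrableOn_Ioi_rpow_of_lt (by linarith) hϱ

theorem memLp_highFactor (hϱ : 0 < ϱ) (ℓ : Fin d) : MemLp (highFactor d ϱ ℓ) 2 := by
  refine (memLp_highModulus hϱ).mono ?_ (.of_forall fun k => ?_)
  · simp only [funext (highFactor_eq_highModulus_mul ϱ ℓ)]
    fun_prop
  · rw [highFactor_eq_highModulus_mul, norm_mul, norm_div, norm_norm]
    exact mul_le_of_le_one_right (norm_nonneg _)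
      (div_le_one_of_le₀ (PiLp.norm_apply_le k ℓ) (norm_nonneg k))

theorem tendsto_integral_sq_highModulus :
    Tendsto (fun R : ℝ => ∫ k, highModulus d R k ^ 2) atTop (𝓝 0) := by
  rw [← integral_zero (Position d) ℝ]
  refine tendsto_integral_filter_of_dominated_convergence (fun k => highModulus d 1 k ^ 2)
    (.of_forall fun R => by fun_prop) ?_ (memLp_highModulus one_pos).integrable_sq
    (.of_forall fun k => tendsto_const_nhds.congr' ?_)
  · filter_upwards [eventually_ge_atTop 1] with R hR
    refine .of_forall fun k => ?_
    rw [Real.norm_of_nonneg (sq_nonneg _)]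
    exact pow_le_pow_left₀ (highModulus_nonneg R k) (highModulus_anti hR k) 2
  · filter_upwards [eventually_ge_atTop ‖k‖] with R hR
    rw [highModulus, if_neg hR.not_gt, zero_pow two_ne_zero]

end Radial

section PolaronPotential

variable {d N : ℕ} {ψ : Wave d N} {ϱ : ℝ}

theorem commutatorForm_eq (G : Fin d → Position d → ℂ) (j : Fin N) (ψ : Wave d N) :
    commutatorForm G j ψ =
      Complex.I * ∑ ℓ, ∫ X, densityDeriv ψ j ℓ X • G ℓ (particle j X) := by
  rw [Finset.mul_sum]
  refine Finset.sum_congr rfl fun ℓ _ => ?_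
  rw [← integral_const_mul]
  congr 1 with X
  have current := conj_mul_momentum_eq ψ j ℓ X
  have current_conj := congr_arg (starRingEnd ℂ) current
  simp only [map_mul, map_sub, map_div₀, Complex.conj_conj, Complex.conj_ofReal, Complex.conj_I,
    map_ofNat] at current_conj
  rw [Complex.real_smul]
  linear_combination G ℓ (particle j X) * (current_conj - current)

theorem InH1.coord_mul_densityFourier_eq (hψ : InH1 ψ) (j : Fin N) (k : Position d) (ℓ : Fin d) :
    k ℓ * densityFourier ψ j k = Complex.I * ∫ X, densityDeriv ψ j ℓ X • planeWave j k X := by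
  rw [hψ.integral_densityDeriv_smul_planeWave]
  linear_combination (k ℓ * densityFourier ψ j k) * Complex.I_mul_I

theorem InH1.integrable_mul_coord_mul_densityFourier (hψ : InH1 ψ) {f : Position d → ℝ}
    (hf : MemLp f 2) (z : PhononSpace d) (j : Fin N) (ℓ : Fin d) :
    Integrable fun k => f k * z k * (k ℓ * densityFourier ψ j k) := by
  simp only [hψ.coord_mul_densityFourier_eq, mul_left_comm _ Complex.I]
  exact (integrable_mul_integral_smul_planeWave (integrable_densityDeriv ψ j ℓ) hf z j).const_mul _

theorem InH1.commutatorForm_invFourierInt (hψ : InH1 ψ) {f : Fin d → Position d → ℝ}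
    (hf : ∀ ℓ, MemLp (f ℓ) 2) (z : PhononSpace d) (j : Fin N) :
    commutatorForm (fun ℓ => invFourierInt (f ℓ) z) j ψ =
      ∫ k, ∑ ℓ, f ℓ k * z k * (k ℓ * densityFourier ψ j k) := by
  rw [integral_finsetSum _ fun ℓ _ => hψ.integrable_mul_coord_mul_densityFourier (hf ℓ) z j ℓ,
    commutatorForm_eq, Finset.mul_sum]
  refine Finset.sum_congr rfl fun ℓ _ => ?_
  rw [integral_smul_invFourierInt (integrable_densityDeriv ψ j ℓ) (hf ℓ), ← integral_const_mul]
  simp only [hψ.coord_mul_densityFourier_eq, mul_left_comm _ Complex.I]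

variable [NeZero d]

theorem InH1.integral_invFourierInt_add_commutatorForm (hψ : InH1 ψ) (hϱ : 0 < ϱ)
    (z : PhononSpace d) (j : Fin N) :
    (∫ X, invFourierInt (lowFactor d ϱ) z (particle j X) * (‖ψ X‖ ^ 2 : ℝ)) +
        commutatorForm (fun ℓ => invFourierInt (highFactor d ϱ ℓ) z) j ψ =
      ∫ k, ((‖k‖ ^ (-((d : ℝ) - 1) / 2) : ℝ) : ℂ) * z k * densityFourier ψ j k := by
  have hψsq := integrable_norm_sq ψ
  have low : ∫ X, invFourierInt (lowFactor d ϱ) z (particle j X) * (‖ψ X‖ ^ 2 : ℝ) =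
      ∫ k, lowFactor d ϱ k * z k * densityFourier ψ j k := by
    simpa only [densityFourier, Complex.real_smul, mul_comm (invFourierInt _ _ _)] using
      integral_smul_invFourierInt hψsq (memLp_lowFactor ϱ) z j
  have low_integrable : Integrable fun k => lowFactor d ϱ k * z k * densityFourier ψ j k :=
    integrable_mul_integral_smul_planeWave hψsq (memLp_lowFactor ϱ) z j
  rw [low, hψ.commutatorForm_invFourierInt (memLp_highFactor hϱ),
    ← integral_add low_integrable (integrable_finsetSum _ fun ℓ _ =>
      hψ.integrable_mul_coord_mul_densityFourier (memLp_highFactor hϱ ℓ) z j ℓ)]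
  congr 1 with k
  rw [← lowFactor_add_norm_mul_highModulus hϱ.le, ← sum_highFactor_mul_coord]
  push_cast
  rw [add_mul, add_mul, Finset.sum_mul, Finset.sum_mul]
  congr 1
  exact Finset.sum_congr rfl fun ℓ _ => by ring

end PolaronPotential

section PolaronSource

variable {d N : ℕ} {ψ : Wave d N} {ϱ : ℝ}

/-- The function `⟨ψ, lam(x_j; k) ψ⟩` of `k`, where `lam` is the polaron form factor, written
through the Fourier integral of the density. -/
noncomputable def polaronProfile (α : ℝ) (ψ : Wave d N) (j : Fin N) (k : Position d) : ℂ :=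
  √α * (‖k‖ ^ (-((d : ℝ) - 1) / 2) : ℝ) * starRingEnd ℂ (densityFourier ψ j k)

theorem polaronFactor_particle (α : ℝ) (j : Fin N) (X : Config d N) (k : Position d) :
    polaronFactor α (particle j X) k =
      √α * (‖k‖ ^ (-((d : ℝ) - 1) / 2) : ℝ) * starRingEnd ℂ (planeWave j k X) := by
  have conj_wave : starRingEnd ℂ (planeWave j k X) =
      Complex.exp (-Complex.I * (⟪k, particle j X⟫_ℝ : ℝ)) := by
    rw [planeWave, ← Complex.exp_conj, map_mul, Complex.conj_I, Complex.conj_ofReal]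
  rw [polaronFactor, conj_wave, neg_div, Real.rpow_neg (norm_nonneg k), Complex.ofReal_inv]
  ring

theorem integral_sum_polaronFactor (α : ℝ) (ψ : Wave d N) (k : Position d) :
    ∫ X, (∑ j, polaronFactor α (particle j X) k) * (‖ψ X‖ ^ 2 : ℝ) =
      ∑ j, polaronProfile α ψ j k := by
  have summand : ∀ (j : Fin N) X, polaronFactor α (particle j X) k * (‖ψ X‖ ^ 2 : ℝ) =
      (√α * (‖k‖ ^ (-((d : ℝ) - 1) / 2) : ℝ)) *
        starRingEnd ℂ ((‖ψ X‖ ^ 2) • planeWave j k X) := fun j X => by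
    rw [polaronFactor_particle, Complex.real_smul, map_mul, Complex.conj_ofReal]
    ring
  have integrable_wave : ∀ j : Fin N, Integrable fun X => (‖ψ X‖ ^ 2) • planeWave j k X :=
    fun j => (integrable_norm_sq ψ).smul_of_top_left (memLp_top_planeWave j k)
  have integrable_conj : ∀ j : Fin N,
      Integrable fun X => starRingEnd ℂ ((‖ψ X‖ ^ 2) • planeWave j k X) :=
    fun j => (Complex.conjLIE.toContinuousLinearEquiv.toContinuousLinearMap).integrable_comp
      (integrable_wave j)
  simp only [Finset.sum_mul, summand]
  rw [integral_finsetSum _ fun j _ => (integrable_conj j).const_mul _]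
  simp only [integral_const_mul, integral_conj, polaronProfile, densityFourier]

theorem InH1.sq_norm_polaronProfile_le (hψ : InH1 ψ) (hϱ : 0 ≤ ϱ) (α : ℝ) (j : Fin N)
    (k : Position d) : ‖polaronProfile α ψ j k‖ ^ 2 ≤ √α ^ 2 *
      (‖ψ‖ ^ 4 * lowFactor d ϱ k ^ 2 +
        4 * ‖ψ‖ ^ 2 * (∑ ℓ, ‖momentum ψ j ℓ‖ ^ 2) * highModulus d ϱ k ^ 2) := by
  calc ‖polaronProfile α ψ j k‖ ^ 2 =
        √α ^ 2 * ((‖k‖ ^ (-((d : ℝ) - 1) / 2)) ^ 2 * ‖densityFourier ψ j k‖ ^ 2) := by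
        simp only [polaronProfile, norm_mul, Complex.norm_real, RCLike.norm_conj, mul_pow,
          Real.norm_eq_abs, sq_abs, mul_assoc]
    _ = √α ^ 2 * (‖densityFourier ψ j k‖ ^ 2 * lowFactor d ϱ k ^ 2 +
        (‖k‖ * ‖densityFourier ψ j k‖) ^ 2 * highModulus d ϱ k ^ 2) := by
        rw [← sq_lowFactor_add_sq_norm_mul_highModulus hϱ]
        ring
    _ ≤ _ := by
        gcongr
        · exact (pow_le_pow_left₀ (norm_nonneg _) (norm_densityFourier_le ψ j k) 2).trans_eq
            (by ring)
        · exact hψ.sq_norm_mul_norm_densityFourier_le j k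

theorem aestronglyMeasurable_polaronProfile (α : ℝ) (ψ : Wave d N) (j : Fin N) :
    AEStronglyMeasurable (polaronProfile α ψ j) := by
  have weight : Measurable fun k : Position d =>
      (√α : ℂ) * (‖k‖ ^ (-((d : ℝ) - 1) / 2) : ℝ) := by fun_prop
  exact weight.aestronglyMeasurable.mul
    (Complex.continuous_conj.comp_aestronglyMeasurable (aestronglyMeasurable_densityFourier ψ j))

open scoped Classical in
/-- The element `⟨ψ, lam(x_j) ψ⟩` of `L²(ℝ^d)`, where `lam` is the polaron form factor; it is `0`
if `polaronProfile α ψ j` is not square integrable, which does not happen for `ψ ∈ H¹`. -/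
noncomputable def polaronSource (α : ℝ) (ψ : Wave d N) (j : Fin N) : PhononSpace d :=
  if h : MemLp (polaronProfile α ψ j) 2 then h.toLp else 0

variable [NeZero d]

theorem integrable_polaronProfile_bound (hϱ : 0 < ϱ) (a b c : ℝ) : Integrable fun k =>
    c * (a * lowFactor d ϱ k ^ 2 + b * highModulus d ϱ k ^ 2) :=
  (((memLp_lowFactor ϱ).integrable_sq.const_mul a).add
    ((memLp_highModulus hϱ).integrable_sq.const_mul b)).const_mul c

theorem InH1.memLp_polaronProfile (hψ : InH1 ψ) (α : ℝ) (j : Fin N) :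
    MemLp (polaronProfile α ψ j) 2 := by
  have meas := aestronglyMeasurable_polaronProfile α ψ j
  rw [memLp_two_iff_integrable_sq_norm meas]
  refine (integrable_polaronProfile_bound one_pos (‖ψ‖ ^ 4)
    (4 * ‖ψ‖ ^ 2 * ∑ ℓ, ‖momentum ψ j ℓ‖ ^ 2) (√α ^ 2)).mono' (meas.norm.pow 2)
    (.of_forall fun k => ?_)
  rw [Real.norm_of_nonneg (sq_nonneg _)]
  exact hψ.sq_norm_polaronProfile_le zero_le_one α j k

theorem InH1.coeFn_polaronSource (hψ : InH1 ψ) (α : ℝ) (j : Fin N) :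
    polaronSource α ψ j =ᵐ[volume] polaronProfile α ψ j := by
  rw [polaronSource, dif_pos (hψ.memLp_polaronProfile α j)]
  exact MemLp.coeFn_toLp _

theorem InH1.polaronPotentialForm_eq (hψ : InH1 ψ) (hϱ : 0 < ϱ) (α : ℝ) (z : PhononSpace d)
    (j : Fin N) :
    polaronPotentialForm α ϱ z j ψ = 2 * (⟪z, polaronSource α ψ j⟫_ℂ).re := by
  have inner_eq : ⟪z, polaronSource α ψ j⟫_ℂ = √α * starRingEnd ℂ
      (∫ k, ((‖k‖ ^ (-((d : ℝ) - 1) / 2) : ℝ) : ℂ) * z k * densityFourier ψ j k) := by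
    rw [L2.inner_def, ← integral_conj, ← integral_const_mul]
    refine integral_congr_ae ?_
    filter_upwards [hψ.coeFn_polaronSource α j] with k hk
    simp only [hk, polaronProfile, RCLike.inner_apply, map_mul, Complex.conj_ofReal]
    ring
  rw [polaronPotentialForm, hψ.integral_invFourierInt_add_commutatorForm hϱ, inner_eq,
    Complex.re_ofReal_mul, Complex.conj_re]
  ring

theorem InH1.sq_norm_polaronSource_le (hψ : InH1 ψ) (hϱ : 0 < ϱ) (α : ℝ) (j : Fin N) :
    ‖polaronSource α ψ j‖ ^ 2 ≤ √α ^ 2 *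
      (‖ψ‖ ^ 4 * (∫ k, lowFactor d ϱ k ^ 2) +
        4 * ‖ψ‖ ^ 2 * (∑ ℓ, ‖momentum ψ j ℓ‖ ^ 2) * ∫ k, highModulus d ϱ k ^ 2) := by
  have low := (memLp_lowFactor (d := d) ϱ).integrable_sq
  have high := (memLp_highModulus (d := d) hϱ).integrable_sq
  rw [← integral_norm_sq, ← integral_const_mul, ← integral_const_mul,
    ← integral_add (low.const_mul _) (high.const_mul _), ← integral_const_mul]
  refine integral_mono_ae (integrable_norm_sq _) (integrable_polaronProfile_bound hϱ _ _ _) ?_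
  filter_upwards [hψ.coeFn_polaronSource α j] with k hk
  rw [hk]
  exact hψ.sq_norm_polaronProfile_le hϱ.le α j k

theorem InH1.polaronFieldEq_iff (hψ : InH1 ψ) (α : ℝ) (η : PhononSpace d) :
    polaronFieldEq α ψ η ↔ η + ∑ j, polaronSource α ψ j = 0 := by
  have sum_eq : (η + ∑ j, polaronSource α ψ j : PhononSpace d) =ᵐ[volume]
      fun k => η k + ∑ j, polaronProfile α ψ j k := by
    filter_upwards [Lp.coeFn_add η (∑ j, polaronSource α ψ j),
      Lp.coeFn_fun_finsetSum Finset.univ (polaronSource α ψ),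
      ae_all_iff.2 (hψ.coeFn_polaronSource α)] with k hadd hsum hsource
    simp only [hadd, Pi.add_apply, hsum, hsource]
  rw [polaronFieldEq, Lp.eq_zero_iff_ae_eq_zero]
  simp only [integral_sum_polaronFactor]
  exact Filter.eventually_congr (by filter_upwards [sum_eq] with k hk; rw [hk, Pi.zero_apply])

theorem InH1.sq_norm_sum_polaronSource_le (hψ : InH1 ψ) (hϱ : 0 < ϱ) (α : ℝ) :
    ‖∑ j, polaronSource α ψ j‖ ^ 2 ≤ N * √α ^ 2 *
      (N * ‖ψ‖ ^ 4 * (∫ k, lowFactor d ϱ k ^ 2) +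
        4 * ‖ψ‖ ^ 2 * (∑ j, ∑ ℓ, ‖momentum ψ j ℓ‖ ^ 2) * ∫ k, highModulus d ϱ k ^ 2) := by
  calc ‖∑ j, polaronSource α ψ j‖ ^ 2 ≤ (∑ j, ‖polaronSource α ψ j‖) ^ 2 := by
        gcongr
        exact norm_sum_le _ _
    _ ≤ N * ∑ j, ‖polaronSource α ψ j‖ ^ 2 := by
        simpa using sq_sum_le_card_mul_sum_sq (s := Finset.univ)
          (f := fun j => ‖polaronSource α ψ j‖)
    _ ≤ N * ∑ j, √α ^ 2 * (‖ψ‖ ^ 4 * (∫ k, lowFactor d ϱ k ^ 2) +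
        4 * ‖ψ‖ ^ 2 * (∑ ℓ, ‖momentum ψ j ℓ‖ ^ 2) * ∫ k, highModulus d ϱ k ^ 2) := by
        gcongr with j
        exact hψ.sq_norm_polaronSource_le hϱ α j
    _ = _ := by
        rw [← Finset.mul_sum, Finset.sum_add_distrib, ← Finset.sum_mul, ← Finset.sum_mul,
          ← Finset.mul_sum]
        simp only [Finset.sum_const, Finset.card_univ, Fintype.card_fin, nsmul_eq_mul]
        ring

-- Raising the momentum cutoff makes the coupling to the high momenta as small as desired, at the
-- price of a large bounded contribution from the low ones.
theorem exists_le_freeForm_sub_sq_norm_polaronSource {W : Config d N → ℝ}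
    (hW : ∀ᵐ X, 0 ≤ W X) (α : ℝ) : ∃ C : ℝ, ∀ ψ ∈ formDomain W, ‖ψ‖ = 1 →
      C ≤ freeForm W ψ - ‖∑ j, polaronSource α ψ j‖ ^ 2 := by
  have small := (tendsto_integral_sq_highModulus (d := d)).const_mul (4 * N * √α ^ 2)
  rw [mul_zero] at small
  obtain ⟨R, hR_small, hR⟩ :=
    ((small.eventually_lt_const one_pos).and (Filter.eventually_gt_atTop 0)).exists
  refine ⟨-(N * √α ^ 2 * (N * ∫ k, lowFactor d R k ^ 2)), fun ψ hψ hψ1 => ?_⟩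
  have source := hψ.1.sq_norm_sum_polaronSource_le hR α
  rw [hψ1] at source
  have kinetic := sum_norm_momentum_sq_le_freeForm hW ψ
  have kinetic_nonneg : 0 ≤ ∑ j, ∑ ℓ, ‖momentum ψ j ℓ‖ ^ 2 :=
    Finset.sum_nonneg fun j _ => Finset.sum_nonneg fun ℓ _ => sq_nonneg _
  have absorbed := mul_le_of_le_one_left kinetic_nonneg hR_small.le
  linarith

theorem polaron_variationalEquivalence {W : Config d N → ℝ} (hW : ∀ᵐ X, 0 ≤ W X) (α : ℝ)
    (hϱ : 0 < ϱ) :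
    VariationalEquivalence (polaronEnergy α ϱ W) (LinearIsometryEquiv.refl ℂ (PhononSpace d))
      (polaronFieldEq α) := by
  obtain ⟨C, hC⟩ := exists_le_freeForm_sub_sq_norm_polaronSource hW α
  refine variationalEquivalence_of_linear (D := formDomain W) (C := C) (freeForm W)
    (fun ψ => ∑ j, polaronSource α ψ j) (fun ψ hψ z => ?_) (fun ψ hψ z => ?_) hC
    fun ψ hψ => hψ.1.polaronFieldEq_iff α
  · simp only [polaronEnergy, hψ, if_false]
  · simp only [polaronEnergy, hψ, if_true, hψ.1.polaronPotentialForm_eq hϱ, inner_sum,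
      Complex.re_sum, Finset.mul_sum, LinearIsometryEquiv.coe_refl, id_eq]

end PolaronSource

theorem mainTheorem8_general {𝔥 : Type*} [NormedAddCommGroup 𝔥] [InnerProductSpace ℂ 𝔥]
    [CompleteSpace 𝔥] (ω : Dispersion 𝔥) (N : ℕ) :
    (∀ (d : ℕ) (W : Config d N → ℝ) (_ : ∀ᵐ X, 0 ≤ W X) (lam : Position d → 𝔥)
        (_ : ∀ᵐ x, lam x ∈ ω.negHalf.domain) (_ : MemLp (fun x => ω.negHalfApply (lam x)) ⊤),
      VariationalEquivalence (nelsonEnergy ω lam W) ω.halfIso (nelsonFieldEq ω lam)) ∧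
    (∀ (d : ℕ) (_ : 0 < d) (W : Config d N → ℝ) (_ : ∀ᵐ X, 0 ≤ W X) (α : ℝ) (_ : 0 ≤ α)
        (ϱ : ℝ) (_ : 0 < ϱ),
      VariationalEquivalence (polaronEnergy α ϱ W) (LinearIsometryEquiv.refl ℂ (PhononSpace d))
        (polaronFieldEq α)) ∧
    (∀ (W : Config 3 N → ℝ) (_ : ∀ᵐ X, 0 ≤ W X) (m : Fin N → ℝ) (_ : ∀ j, 0 < m j) (e : ℝ)
        (lam : Fin N → Fin 3 → Position 3 → 𝔥) (_ : ∀ j ℓ, IsFormFactor ω (lam j ℓ))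
        (_ : ∀ j, IsDivergenceFree (lam j)),
      VariationalEquivalence (pauliFierzEnergy ω m e lam W) ω.halfIso
        (pauliFierzFieldEq ω m e lam)) :=
  ⟨fun _ _ hW _ _ hneg => nelson_variationalEquivalence hW hneg,
    fun _ hd _ hW α _ _ hϱ =>
      have : NeZero _ := .of_pos hd
      polaron_variationalEquivalence hW α hϱ,
    fun _ hW _ hm _ _ hlam hdiv => pauliFierz_variationalEquivalence hW hm
      (fun j ℓ => (hlam j ℓ).2.1) (fun j ℓ => (hlam j ℓ).1) (fun j ℓ => (hlam j ℓ).2.2) hdiv⟩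

theorem mainTheorem8 {𝔥 : Type*} [NormedAddCommGroup 𝔥] [InnerProductSpace ℂ 𝔥]
    [CompleteSpace 𝔥] (ω : Dispersion 𝔥) (N : ℕ) :
    -- (a) the Nelson model
    (∀ (d : ℕ) (_ : d ∈ ({1, 2, 3} : Set ℕ)) (W : Config d N → ℝ) (_ : IsPotential W)
        (lam : Position d → 𝔥) (_ : IsFormFactor ω lam),
      VariationalEquivalence (nelsonEnergy ω lam W) ω.halfIso (nelsonFieldEq ω lam)) ∧
    -- (b) the polaron
    (∀ (d : ℕ) (_ : d ∈ ({1, 2, 3} : Set ℕ)) (W : Config d N → ℝ) (_ : IsPotential W)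
        (α : ℝ) (_ : 0 < α) (ϱ : ℝ) (_ : 0 < ϱ),
      VariationalEquivalence (polaronEnergy α ϱ W) (LinearIsometryEquiv.refl ℂ (PhononSpace d))
        (polaronFieldEq α)) ∧
    -- (c) the Pauli-Fierz model
    (∀ (W : Config 3 N → ℝ) (_ : IsPotential W) (m : Fin N → ℝ) (_ : ∀ j, 0 < m j) (e : ℝ)
        (lam : Fin N → Fin 3 → Position 3 → 𝔥) (_ : ∀ j ℓ, IsFormFactor ω (lam j ℓ))
        (_ : ∀ j ℓ, (∀ᵐ x, lam j ℓ x ∈ ω.half.domain) ∧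
          MemLp (fun x => ω.halfApply (lam j ℓ x)) ⊤)
        (_ : ∀ j, IsDivergenceFree (lam j)),
      VariationalEquivalence (pauliFierzEnergy ω m e lam W) ω.halfIso
        (pauliFierzFieldEq ω m e lam)) := by
  obtain ⟨nelson, polaron, pauliFierz⟩ := mainTheorem8_general ω N
  refine ⟨fun d _ W hW lam hlam => nelson d W hW.2 lam hlam.2.1 hlam.2.2,
    fun d hd W hW α hα ϱ hϱ => polaron d (Nat.pos_of_ne_zero ?_) W hW.2 α hα.le ϱ hϱ,
    fun W hW m hm e lam hlam _ hdiv => pauliFierz W hW.2 m hm e lam hlam hdiv⟩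
  rcases hd with rfl | rfl | rfl <;> norm_num
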